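/- **DCDSs.** Fix a countably infinite set $\mathcal C$ of constants (with a fixed numbering, $\mathcal C=\mathbb N$). A *data-centric dynamic system* (DCDS) $\mathcal S$ is a finite description consisting of * a relational schema $\mathcal R$; a finite set $\mathcal E$ of equality constraints $Q\to\bigwedge_j z_j=y_j$, where $Q$ is a domain-independent first-order query and each $z_j,y_j$ is a free variable of $Q$ or a constant; and a finite initial instance $\mathcal I_0$ of $\mathcal R$ that satisfies $\mathcal E$; * a finite set $\mathcal F$ of service names with arities; a finite set of actions $\alpha(p_1,\dots,p_n)$, each with finitely many effects $q^+\wedge Q^-\rightsquigarrow E$, where $q^+$ is a union of conjunctive queries, $Q^-$ is a first-order formula whose free variables are among those of $q^+$ and the parameters, and $E$ is a finite set of facts over constants, parameters, free variables of $q^+$, and service calls $f(\vec t)$ with $f\in\mathcal F$ applied to such terms; and a finite set of rules $Q\mapsto\alpha$, where $Q$ is a first-order query whose free variables are exactly the parameters of $\alpha$. All constants used occur in $\mathcal I_0$, and queries are evaluated under the active-domain semantics. **Steps.** Given an instance $\mathcal I$, an action $\alpha$ and an assignment $\sigma$ of its parameters that is an answer over $\mathcal I$ to the guard of a rule for $\alpha$,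 let $\mathrm{DO}(\mathcal I,\alpha\sigma)$ be the union of the sets $E\sigma\theta$ over all effects of $\alpha$ and all answers $\theta$ to $(q^+\wedge Q^-)\sigma$ over $\mathcal I$. Each ground service call in it is replaced by a constant, the same one for all its occurrences, and the result is the next instance provided that it satisfies $\mathcal E$. * With *nondeterministic services* the constants are chosen arbitrarily in each step, and the states of the concrete transition system are the instances, with initial state $\mathcal I_0$. * With *deterministic services* the states are pairs $\langle\mathcal I,\mathcal M\rangle$, where $\mathcal M$ is the partial map recording the results of all service calls made so far; recorded calls keep their result, new calls get arbitrary constants, which are recorded, and the initial state is $\langle\mathcal I_0,\emptyset\rangle$. Denote the concrete transition systems by $\Upsilon^{\mathrm{det}}_{\mathcal S}$ and $\Upsilon^{\mathrm{nondet}}_{\mathcal S}$. For a propositional LTL formula $\Phi$ whose atoms are nullary relations, $\Upsilon\models\Phi$ means that every maximal run of $\Upsilon$ from its initial state (infinite, or ending in a state without successors) satisfies $\Phi$. **Theorem.** Let $\Phi=\mathbf G\,\neg\mathit{halted}$ for a nullary relation $\mathit{halted}$. 1. The following problem is undecidable: given a DCDS $\mathcal S$ whose schema contains $\mathit{halted}$,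 does $\Upsilon^{\mathrm{det}}_{\mathcal S}\models\Phi$ hold? 2. The same problem for $\Upsilon^{\mathrm{nondet}}_{\mathcal S}\models\Phi$ is undecidable. 3. There is even a single DCDS $\mathcal S$, whose schema contains $\mathit{halted}$, such that both problems are undecidable when only the initial instance is the input: given a finite instance $\mathcal I_0'$ for which the schema, constraints and process layer of $\mathcal S$ together with $\mathcal I_0'$ form a DCDS $\mathcal S[\mathcal I_0']$, neither $\Upsilon^{\mathrm{det}}_{\mathcal S[\mathcal I_0']}\models\Phi$ nor $\Upsilon^{\mathrm{nondet}}_{\mathcal S[\mathcal I_0']}\models\Phi$ is decidable. Here a problem is undecidable if no algorithm, reading the finite description of the input, answers correctly on all admissible inputs. -/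

import Mathlib

/-! Data-centric dynamic systems (DCDSs), their concrete transition systems under deterministic
and under nondeterministic services, propositional LTL over them, and decidability of problems
about them.  The countably infinite set of constants is `ℕ`; relation, function, action and
variable names are natural numbers as well, so that a DCDS is a finite object. -/

namespace DCDSVerif

/-- A fact `R(c₁, …, cₙ)` over the constants. -/
abbrev Fact := ℕ × List ℕ

/-- A relational instance; all instances that occur below are finite. -/
abbrev Instance := Set Fact

/-- The active domain of an instance. -/
def adom (I : Instance) : Set ℕ := {c | ∃ f ∈ I, c ∈ f.2}

/-- The instance uses only the declared relations, with the declared arities. -/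
def Conforms (schema : List (ℕ × ℕ)) (I : Instance) : Prop :=
  ∀ f ∈ I, (f.1, f.2.length) ∈ schema

/-! ### First-order queries -/

/-- Terms of queries.  The parameters of an action are variables, too. -/
inductive Term where
  | var (x : ℕ)
  | const (c : ℕ)
  deriving DecidableEq

namespace Term

def eval (v : ℕ → ℕ) : Term → ℕ
  | var x => v x
  | const c => c

def fv : Term → Finset ℕ
  | var x => {x}
  | const _ => ∅

def consts : Term → Finset ℕ
  | var _ => ∅
  | const c => {c}

def code : Term → ℕ
  | var x => 2 * x
  | const c => 2 * c + 1

end Term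

/-- First-order formulas with equality over a relational vocabulary. -/
inductive FO where
  | tru
  | rel (R : ℕ) (ts : List Term)
  | eq (s t : Term)
  | neg (φ : FO)
  | and (φ ψ : FO)
  | or (φ ψ : FO)
  | ex (x : ℕ) (φ : FO)

namespace FO

def fv : FO → Finset ℕ
  | tru => ∅
  | rel _ ts => ts.toFinset.biUnion Term.fv
  | eq s t => s.fv ∪ t.fv
  | neg φ => φ.fv
  | and φ ψ => φ.fv ∪ ψ.fv
  | or φ ψ => φ.fv ∪ ψ.fv
  | ex x φ => φ.fv.erase x

def consts : FO → Finset ℕ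
  | tru => ∅
  | rel _ ts => ts.toFinset.biUnion Term.consts
  | eq s t => s.consts ∪ t.consts
  | neg φ => φ.consts
  | and φ ψ => φ.consts ∪ ψ.consts
  | or φ ψ => φ.consts ∪ ψ.consts
  | ex _ φ => φ.consts

/-- All relational atoms respect the schema. -/
def OverSchema (schema : List (ℕ × ℕ)) : FO → Prop
  | tru => True
  | rel R ts => (R, ts.length) ∈ schema
  | eq _ _ => True
  | neg φ => φ.OverSchema schema
  | and φ ψ => φ.OverSchema schema ∧ ψ.OverSchema schema
  | or φ ψ => φ.OverSchema schema ∧ ψ.OverSchema schema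
  | ex _ φ => φ.OverSchema schema

/-- `I ⊨ φ` under the valuation `v`, with quantifiers ranging over `D`. -/
def Sat (D : Set ℕ) (I : Instance) : FO → (ℕ → ℕ) → Prop
  | tru, _ => True
  | rel R ts, v => (R, ts.map (Term.eval v)) ∈ I
  | eq s t, v => s.eval v = t.eval v
  | neg φ, v => ¬ φ.Sat D I v
  | and φ ψ, v => φ.Sat D I v ∧ ψ.Sat D I v
  | or φ ψ, v => φ.Sat D I v ∨ ψ.Sat D I v
  | ex x φ, v => ∃ d ∈ D, φ.Sat D I (Function.update v x d)

/-- The valuation `v` (of which only the values at the free variables matter) is an answer to `φ`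
over `I`, for the evaluation domain `D`. -/
def IsAnswerOn (D : Set ℕ) (I : Instance) (φ : FO) (v : ℕ → ℕ) : Prop :=
  (∀ x ∈ φ.fv, v x ∈ D) ∧ φ.Sat D I v

/-- The domain over which `φ` is evaluated in `I`: the values occurring in `I` or in `φ`. -/
def evalDom (I : Instance) (φ : FO) : Set ℕ := adom I ∪ φ.consts

/-- `v ∈ ans(φ, I)`, with the active-domain semantics. -/
def IsAnswer (I : Instance) (φ : FO) (v : ℕ → ℕ) : Prop :=
  φ.IsAnswerOn (φ.evalDom I) I v

/-- Domain independence: no larger evaluation domain changes the answers. -/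
def DomainIndependent (schema : List (ℕ × ℕ)) (φ : FO) : Prop :=
  ∀ I : Instance, I.Finite → Conforms schema I → ∀ D : Set ℕ, φ.evalDom I ⊆ D →
    ∀ v : ℕ → ℕ, φ.IsAnswerOn D I v ↔ φ.IsAnswer I v

/-- Conjunctive queries: built from relational atoms by conjunction and existential
quantification (`tru` is the empty conjunction). -/
inductive IsCQ : FO → Prop
  | tru : IsCQ tru
  | rel (R : ℕ) (ts : List Term) : IsCQ (rel R ts)
  | and {φ ψ : FO} : IsCQ φ → IsCQ ψ → IsCQ (and φ ψ)
  | ex (x : ℕ) {φ : FO} : IsCQ φ → IsCQ (ex x φ)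

/-- Unions of conjunctive queries; apart from the parameters `P`, all disjuncts have the same free
variables. -/
inductive IsUCQ (P : Finset ℕ) : FO → Prop
  | cq {φ : FO} : IsCQ φ → IsUCQ P φ
  | or {φ ψ : FO} : IsUCQ P φ → IsUCQ P ψ → φ.fv \ P = ψ.fv \ P → IsUCQ P (or φ ψ)

def code : FO → ℕ
  | tru => Nat.pair 0 0
  | rel R ts => Nat.pair 1 (Nat.pair R (Encodable.encode (ts.map Term.code)))
  | eq s t => Nat.pair 2 (Nat.pair s.code t.code)
  | neg φ => Nat.pair 3 φ.code
  | and φ ψ => Nat.pair 4 (Nat.pair φ.code ψ.code)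
  | or φ ψ => Nat.pair 5 (Nat.pair φ.code ψ.code)
  | ex x φ => Nat.pair 6 (Nat.pair x φ.code)

end FO

/-! ### Data layer and process layer -/

/-- An equality constraint `Q → ⋀ⱼ zⱼ = yⱼ`. -/
structure EqConstraint where
  query : FO
  eqs : List (Term × Term)

/-- `I` satisfies the equality constraint. -/
def EqConstraint.Holds (E : EqConstraint) (I : Instance) : Prop :=
  ∀ v : ℕ → ℕ, E.query.IsAnswer I v → ∀ e ∈ E.eqs, e.1.eval v = e.2.eval v

/-- Terms in the heads of effects: plain terms, or service calls `f(t₁, …, tₙ)`. -/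
inductive HeadTerm where
  | plain (t : Term)
  | call (f : ℕ) (args : List Term)

/-- A ground service call `f(c₁, …, cₙ)`. -/
abbrev Call := ℕ × List ℕ

namespace HeadTerm

def ground (v : ℕ → ℕ) : HeadTerm → ℕ ⊕ Call
  | plain t => Sum.inl (t.eval v)
  | call f args => Sum.inr (f, args.map (Term.eval v))

def fv : HeadTerm → Finset ℕ
  | plain t => t.fv
  | call _ args => args.toFinset.biUnion Term.fv

def consts : HeadTerm → Finset ℕ
  | plain t => t.consts
  | call _ args => args.toFinset.biUnion Term.consts

/-- The functions that are called are declared, with the right arities. -/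
def OverFuncs (funcs : List (ℕ × ℕ)) : HeadTerm → Prop
  | plain _ => True
  | call f args => (f, args.length) ∈ funcs

def code : HeadTerm → ℕ
  | plain t => 2 * t.code
  | call f args => 2 * Nat.pair f (Encodable.encode (args.map Term.code)) + 1

end HeadTerm

/-- An effect specification `q⁺ ∧ Q⁻ ⇝ E`. -/
structure Effect where
  pos : FO
  filter : FO
  head : List (ℕ × List HeadTerm)

/-- An action `α(p₁, …, pₙ) : {e₁, …, eₘ}`. -/
structure Action where
  name : ℕ
  params : List ℕ
  effects : List Effect

/-- A condition-action rule `Q ↦ α`; the action is given by its name. -/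
structure Rule where
  guard : FO
  action : ℕ

/-- The (finite) description of a DCDS: schema, equality constraints and initial instance of the
data layer; service interfaces, actions and rules of the process layer. Relations and functions
are declared as pairs (name, arity). -/
structure DCDS where
  schema : List (ℕ × ℕ)
  constraints : List EqConstraint
  init : List Fact
  funcs : List (ℕ × ℕ)
  actions : List Action
  rules : List Rule

namespace DCDS

/-- The initial instance, as a set of facts. -/
def initInst (S : DCDS) : Instance := {f | f ∈ S.init}

/-- The same schema, constraints and process layer, with another initial instance. -/
def withInit (S : DCDS) (I₀ : List Fact) : DCDS := { S with init := I₀ }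

/-- All equality constraints hold in `I`. -/
def Consistent (S : DCDS) (I : Instance) : Prop := ∀ E ∈ S.constraints, E.Holds I

/-- A query over the schema whose constants come from the initial instance. -/
def IsQuery (S : DCDS) (φ : FO) : Prop :=
  φ.OverSchema S.schema ∧ ∀ c ∈ φ.consts, c ∈ adom S.initInst

/-- Conditions on an equality constraint of a DCDS. -/
structure IsConstraint (S : DCDS) (E : EqConstraint) : Prop where
  query : S.IsQuery E.query
  domainIndependent : E.query.DomainIndependent S.schema
  vars : ∀ e ∈ E.eqs, e.1.fv ∪ e.2.fv ⊆ E.query.fv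
  consts : ∀ e ∈ E.eqs, ∀ c ∈ e.1.consts ∪ e.2.consts, c ∈ adom S.initInst

/-- Conditions on an effect specification of an action with parameters `P`. -/
structure IsEffect (S : DCDS) (P : Finset ℕ) (e : Effect) : Prop where
  pos : S.IsQuery e.pos
  ucq : e.pos.IsUCQ P
  filter : S.IsQuery e.filter
  filter_vars : e.filter.fv ⊆ e.pos.fv ∪ P
  head_schema : ∀ h ∈ e.head, (h.1, h.2.length) ∈ S.schema
  head_funcs : ∀ h ∈ e.head, ∀ t ∈ h.2, t.OverFuncs S.funcs
  head_vars : ∀ h ∈ e.head, ∀ t ∈ h.2, t.fv ⊆ e.pos.fv ∪ P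
  head_consts : ∀ h ∈ e.head, ∀ t ∈ h.2, ∀ c ∈ t.consts, c ∈ adom S.initInst

/-- The description is that of a DCDS. -/
structure IsValid (S : DCDS) : Prop where
  schema_names : (S.schema.map Prod.fst).Nodup
  func_names : (S.funcs.map Prod.fst).Nodup
  action_names : (S.actions.map Action.name).Nodup
  init_conforms : Conforms S.schema S.initInst
  constraints : ∀ E ∈ S.constraints, S.IsConstraint E
  init_consistent : S.Consistent S.initInst
  params : ∀ α ∈ S.actions, α.params.Nodup
  effects : ∀ α ∈ S.actions, ∀ e ∈ α.effects, S.IsEffect α.params.toFinset e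
  rule_query : ∀ r ∈ S.rules, S.IsQuery r.guard
  rule_action : ∀ r ∈ S.rules, ∃ α ∈ S.actions, α.name = r.action ∧
    r.guard.fv = α.params.toFinset

end DCDS

/-! ### Execution of actions -/

/-- The assignment `v` of values to the parameters and to the variables of the effect `e` extends
`σ` and is an answer to `(q⁺ ∧ Q⁻)σ` over `I`; the parameter values are constants of that query. -/
def Effect.Fires (e : Effect) (params : List ℕ) (I : Instance) (σ v : ℕ → ℕ) : Prop :=
  (∀ p ∈ params, v p = σ p) ∧
  (FO.and e.pos e.filter).IsAnswerOn
    ((FO.and e.pos e.filter).evalDom I ∪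
      {c | ∃ p ∈ params, p ∈ (FO.and e.pos e.filter).fv ∧ c = σ p}) I v

/-- `DO(I, ασ)`: a set of facts over constants and ground service calls. -/
def Action.doo (α : Action) (I : Instance) (σ : ℕ → ℕ) : Set (ℕ × List (ℕ ⊕ Call)) :=
  {g | ∃ e ∈ α.effects, ∃ v : ℕ → ℕ, e.Fires α.params I σ v ∧
    ∃ h ∈ e.head, g = (h.1, h.2.map (HeadTerm.ground v))}

/-- The service calls that occur in a set of facts. -/
def callsOf (E : Set (ℕ × List (ℕ ⊕ Call))) : Set Call := {c | ∃ g ∈ E, Sum.inr c ∈ g.2}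

/-- A service call map: a partial function from service calls to constants. -/
abbrev CallMap := Call → Option ℕ

/-- The constant that a ground term stands for under a service call map. -/
def CallMap.value (M : CallMap) : ℕ ⊕ Call → Option ℕ
  | Sum.inl c => some c
  | Sum.inr k => M k

/-- `M(E)`: the instance obtained by applying a service call map to a set of facts. -/
def CallMap.apply (M : CallMap) (E : Set (ℕ × List (ℕ ⊕ Call))) : Instance :=
  {f | ∃ g ∈ E, f.1 = g.1 ∧ g.2.map M.value = f.2.map some}

/-- `M'` is a possible result of `serviceCalls`: it keeps the recorded results of `M` and binds
exactly the new calls of `E`, each to an arbitrary constant. -/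
def CallMap.Extends (M : CallMap) (E : Set (ℕ × List (ℕ ⊕ Call))) (M' : CallMap) : Prop :=
  ∀ k : Call, (∀ c, M k = some c → M' k = some c) ∧
    (M k = none → (k ∈ callsOf E ↔ ∃ c, M' k = some c))

/-- Some rule for `α` allows the parameter assignment `σ` in `I`. -/
def DCDS.Legal (S : DCDS) (I : Instance) (α : Action) (σ : ℕ → ℕ) : Prop :=
  α ∈ S.actions ∧ ∃ r ∈ S.rules, r.action = α.name ∧ r.guard.IsAnswer I σ

/-! ### Transition systems -/

/-- A transition system whose states are labelled by instances.  Its set of states proper is the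
part of `State` that is reachable from `init`. -/
structure TransitionSystem where
  State : Type
  init : State
  db : State → Instance
  step : State → State → Prop

/-- The concrete transition system of a DCDS with deterministic services. -/
def DCDS.ctsDet (S : DCDS) : TransitionSystem where
  State := Instance × CallMap
  init := (S.initInst, fun _ => none)
  db s := s.1
  step s s' := ∃ (α : Action) (σ : ℕ → ℕ), S.Legal s.1 α σ ∧
    s.2.Extends (α.doo s.1 σ) s'.2 ∧
    s'.1 = s'.2.apply (α.doo s.1 σ) ∧
    S.Consistent s'.1

/-- The concrete transition system of a DCDS with nondeterministic services: within one step all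
occurrences of a call get the same result, and nothing is remembered across steps. -/
def DCDS.ctsNondet (S : DCDS) : TransitionSystem where
  State := Instance
  init := S.initInst
  db I := I
  step I I' := ∃ (α : Action) (σ : ℕ → ℕ) (θ : Call → ℕ), S.Legal I α σ ∧
    I' = CallMap.apply (fun k => some (θ k)) (α.doo I σ) ∧
    S.Consistent I'

namespace TransitionSystem

/-- `τ 0, τ 1, …` up to index `N` (all of `τ` if `N = ⊤`) is a run of `T`. -/
def IsRun (T : TransitionSystem) (N : ℕ∞) (τ : ℕ → T.State) : Prop :=
  τ 0 = T.init ∧ ∀ i : ℕ, (i : ℕ∞) < N → T.step (τ i) (τ (i + 1))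

/-- A maximal run: it is infinite, or its last state has no successor. -/
def IsMaximalRun (T : TransitionSystem) (N : ℕ∞) (τ : ℕ → T.State) : Prop :=
  T.IsRun N τ ∧ ∀ n : ℕ, N = n → ∀ s, ¬ T.step (τ n) s

end TransitionSystem

/-! ### Propositional LTL -/

/-- Propositional LTL; the atomic propositions are the nullary relations. -/
inductive LTL where
  | atom (p : ℕ)
  | neg (φ : LTL)
  | and (φ ψ : LTL)
  | next (φ : LTL)
  | untl (φ ψ : LTL)

namespace LTL

/-- Truth at position `i` of the finite or infinite sequence `I 0, I 1, …` of instances with last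
index `N`. -/
def Holds (N : ℕ∞) (I : ℕ → Instance) : LTL → ℕ → Prop
  | atom p, i => (p, []) ∈ I i
  | neg φ, i => ¬ φ.Holds N I i
  | and φ ψ, i => φ.Holds N I i ∧ ψ.Holds N I i
  | next φ, i => (i : ℕ∞) < N ∧ φ.Holds N I (i + 1)
  | untl φ ψ, i => ∃ j, i ≤ j ∧ (j : ℕ∞) ≤ N ∧ ψ.Holds N I j ∧
      ∀ k, i ≤ k → k < j → φ.Holds N I k

/-- `true` is `¬(φ ∧ ¬φ)`. -/
def tru : LTL := neg (and (atom 0) (neg (atom 0)))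

/-- `F φ = true U φ`. -/
def eventually (φ : LTL) : LTL := untl tru φ

/-- `G φ = ¬ F ¬ φ`. -/
def always (φ : LTL) : LTL := neg (eventually (neg φ))

end LTL

/-- `T ⊨ Φ`: all maximal runs of `T` satisfy the LTL formula `Φ`. -/
def TransitionSystem.Models (T : TransitionSystem) (Φ : LTL) : Prop :=
  ∀ (N : ℕ∞) (τ : ℕ → T.State), T.IsMaximalRun N τ → Φ.Holds N (fun i => T.db (τ i)) 0

/-! ### Finite codes and decision problems -/

/-- Codes of DCDSs: nested lists and tuples of natural numbers. -/
abbrev DCDSCode :=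
  List (ℕ × ℕ) × List (ℕ × List (ℕ × ℕ)) × List (ℕ × List ℕ) × List (ℕ × ℕ) ×
    List (ℕ × List ℕ × List (ℕ × ℕ × List (ℕ × List ℕ))) × List (ℕ × ℕ)

def EqConstraint.code (E : EqConstraint) : ℕ × List (ℕ × ℕ) :=
  (E.query.code, E.eqs.map fun e => (e.1.code, e.2.code))

def Effect.code (e : Effect) : ℕ × ℕ × List (ℕ × List ℕ) :=
  (e.pos.code, e.filter.code, e.head.map fun h => (h.1, h.2.map HeadTerm.code))

def Action.code (α : Action) : ℕ × List ℕ × List (ℕ × ℕ × List (ℕ × List ℕ)) :=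
  (α.name, α.params, α.effects.map Effect.code)

def Rule.code (r : Rule) : ℕ × ℕ := (r.guard.code, r.action)

def DCDS.code (S : DCDS) : DCDSCode :=
  (S.schema, S.constraints.map EqConstraint.code, S.init, S.funcs,
    S.actions.map Action.code, S.rules.map Rule.code)

theorem Term.code_injective : Function.Injective Term.code := by
  intro s t h
  cases s <;> cases t <;> simp only [Term.code] at h <;> first | omega | (congr 1; omega)

theorem FO.code_injective : Function.Injective FO.code := by
  intro φ
  induction φ with
  | tru => intro ψ h; cases ψ <;> simp_all [FO.code, Nat.pair_eq_pair]
  | rel R ts =>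
    intro ψ h
    cases ψ <;> simp [FO.code, Nat.pair_eq_pair] at h
    obtain ⟨rfl, h⟩ := h
    rw [Term.code_injective.list_map h]
  | eq s t =>
    intro ψ h
    cases ψ <;> simp [FO.code, Nat.pair_eq_pair] at h
    rw [Term.code_injective h.1, Term.code_injective h.2]
  | neg φ ih =>
    intro ψ h
    cases ψ <;> simp [FO.code, Nat.pair_eq_pair] at h
    rw [ih h]
  | and φ φ' ih ih' =>
    intro ψ h
    cases ψ <;> simp [FO.code, Nat.pair_eq_pair] at h
    rw [ih h.1, ih' h.2]
  | or φ φ' ih ih' =>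
    intro ψ h
    cases ψ <;> simp [FO.code, Nat.pair_eq_pair] at h
    rw [ih h.1, ih' h.2]
  | ex x φ ih =>
    intro ψ h
    cases ψ <;> simp [FO.code, Nat.pair_eq_pair] at h
    obtain ⟨rfl, h⟩ := h
    rw [ih h]

theorem HeadTerm.code_injective : Function.Injective HeadTerm.code := by
  intro s t h
  cases s with
  | plain s =>
    cases t with
    | plain t => exact congrArg plain (Term.code_injective (by simpa [HeadTerm.code] using h))
    | call g bs => simp only [HeadTerm.code] at h; omega
  | call f as =>
    cases t with
    | plain t => simp only [HeadTerm.code] at h; omega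
    | call g bs =>
      simp [HeadTerm.code, Nat.pair_eq_pair] at h
      obtain ⟨rfl, h⟩ := h
      rw [Term.code_injective.list_map h]

/-- Distinct descriptions have distinct codes. -/
theorem DCDS.code_injective : Function.Injective DCDS.code := by
  have hE : Function.Injective EqConstraint.code := by
    rintro ⟨q, es⟩ ⟨q', es'⟩ h
    simp only [EqConstraint.code, Prod.mk.injEq] at h
    have hp : Function.Injective fun e : Term × Term => (e.1.code, e.2.code) :=
      Term.code_injective.prodMap Term.code_injective
    rw [FO.code_injective h.1, hp.list_map h.2]
  have he : Function.Injective Effect.code := by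
    rintro ⟨p, f, hd⟩ ⟨p', f', hd'⟩ h
    simp only [Effect.code, Prod.mk.injEq] at h
    have hp : Function.Injective fun g : ℕ × List HeadTerm => (g.1, g.2.map HeadTerm.code) :=
      Function.injective_id.prodMap HeadTerm.code_injective.list_map
    rw [FO.code_injective h.1, FO.code_injective h.2.1, hp.list_map h.2.2]
  have hA : Function.Injective Action.code := by
    rintro ⟨n, ps, es⟩ ⟨n', ps', es'⟩ h
    simp only [Action.code, Prod.mk.injEq] at h
    rw [h.1, h.2.1, he.list_map h.2.2]
  have hR : Function.Injective Rule.code := by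
    rintro ⟨g, a⟩ ⟨g', a'⟩ h
    simp only [Rule.code, Prod.mk.injEq] at h
    rw [FO.code_injective h.1, h.2]
  rintro ⟨s, c, i, f, a, r⟩ ⟨s', c', i', f', a', r'⟩ h
  simp only [DCDS.code, Prod.mk.injEq] at h
  obtain ⟨rfl, h2, rfl, rfl, h5, h6⟩ := h
  rw [hE.list_map h2, hA.list_map h5, hR.list_map h6]

/-- The problem "given `a` with `Inp a`, does `Q a` hold?" is decidable: some algorithm that reads
the code of `a` answers it correctly on all admissible inputs. -/
def IsDecidable {A B : Type} [Primcodable B] (code : A → B) (Inp : A → Prop) (Q : A → Prop) :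
    Prop :=
  ∃ P : B → Prop, ComputablePred P ∧ ∀ a : A, Inp a → (P (code a) ↔ Q a)

end DCDSVerif

/-! The halting problem of a fixed `Turing.ToPartrec.Code` `C` on inputs `[n]` reduces to the
complement of the model checking problem. The process layer is a fixed Datalog program run as a
single action. Its facts describe lists of naturals, named by constants, and evaluations of codes on
them. Service calls supply names for longer lists: one service prepends `0`, the other increments
the head. The code and its input are stored in the initial instance, so one process layer serves all
inputs.

Services may answer arbitrarily, and one constant could then name two different lists. The guard
`Good` blocks the action as soon as a constant is constructed in two ways. A list may have several
names; this is harmless.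

Soundness (`SoundInst.next`, `soundInst_of_isRun`): a step starts from a good instance, where each
constant stands for at most one list, so every derived fact is true and `halted` appears only if `C`
halts. This covers all runs, including those that get stuck.

Completeness (`mem_limit_of_derives`, `eval_mem_limit`): if the services return the standard
encoding of the intended list, the guard never fails. The run is infinite, its facts are closed
under the clauses, and every terminating evaluation is eventually derived.

A deterministic step is in particular a nondeterministic one, and the canonical answers depend only
on the call, so both semantics are handled together. Undecidability for varying systems follows from
that for a fixed system with varying initial instance. -/

namespace DCDSVerif

/-! ### Big-step semantics of `Turing.ToPartrec.Code` -/

section BigStep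

open Turing.ToPartrec Turing.ToPartrec.Code

/-- `BigStep c v w`: the code `c` evaluates to `w` on the input `v`. -/
inductive BigStep : Code → List ℕ → List ℕ → Prop
  | zero' (v) : BigStep zero' v (0 :: v)
  | succ (v) : BigStep succ v [v.headI + 1]
  | tail (v) : BigStep tail v v.tail
  | cons {f g v x y} : BigStep f v x → BigStep g v y → BigStep (cons f g) v (x.headI :: y)
  | comp {f g v x w} : BigStep g v x → BigStep f x w → BigStep (comp f g) v w
  | case_zero {f g v w} : v.headI = 0 → BigStep f v.tail w → BigStep (case f g) v w
  | case_succ {f g n v w} : BigStep g (n :: v) w → BigStep (case f g) ((n + 1) :: v) w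
  | fix_done {f v x} : BigStep f v x → x.headI = 0 → BigStep (fix f) v x.tail
  | fix_step {f v n t w} : BigStep f v ((n + 1) :: t) → BigStep (fix f) t w → BigStep (fix f) v w

/-- The relational form replaces `PFun.fix` by finite derivation trees, whose nodes match the
evaluation clauses of the interpreter one by one. -/
theorem BigStep.mem_eval {c : Code} {v w : List ℕ} (h : BigStep c v w) : w ∈ c.eval v := by
  induction h with
  | zero' v => simp [pure]
  | succ v => simp [pure]
  | tail v => simp [pure]
  | cons _ _ ih ih' =>
    rw [cons_eval]
    exact Part.mem_bind_iff.2 ⟨_, ih, Part.mem_bind_iff.2 ⟨_, ih', Part.mem_some _⟩⟩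
  | comp _ _ ih ih' =>
    rw [comp_eval]
    exact Part.mem_bind_iff.2 ⟨_, ih, ih'⟩
  | case_zero h _ ih => simpa [h] using ih
  | case_succ _ ih => simpa using ih
  | fix_done _ h ih =>
    rw [fix_eval]
    exact PFun.mem_fix_iff.2 (Or.inl ((Part.mem_map_iff _).2 ⟨_, ih, by simp [h]⟩))
  | fix_step _ _ ih ih' =>
    rw [fix_eval] at ih' ⊢
    exact PFun.mem_fix_iff.2 (Or.inr ⟨_, (Part.mem_map_iff _).2 ⟨_, ih, by simp⟩, ih'⟩)

theorem BigStep.of_mem_eval {c : Code} {v w : List ℕ} (h : w ∈ c.eval v) : BigStep c v w := by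
  induction c generalizing v w with
  | zero' => simp [pure] at h; subst h; exact .zero' v
  | succ => simp [pure] at h; subst h; exact .succ v
  | tail => simp [pure] at h; subst h; exact .tail v
  | cons f g ihf ihg =>
    rw [cons_eval] at h
    obtain ⟨x, hx, h⟩ := Part.mem_bind_iff.1 h
    obtain ⟨y, hy, h⟩ := Part.mem_bind_iff.1 h
    cases Part.mem_some_iff.1 h
    exact .cons (ihf hx) (ihg hy)
  | comp f g ihf ihg =>
    rw [comp_eval] at h
    obtain ⟨x, hx, hw⟩ := Part.mem_bind_iff.1 h
    exact .comp (ihg hx) (ihf hw)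
  | case f g ihf ihg =>
    rcases v with _ | ⟨_ | n, v⟩
    · exact .case_zero rfl (ihf (by simpa using h))
    · exact .case_zero rfl (ihf (by simpa using h))
    · exact .case_succ (ihg (by simpa using h))
  | fix f ihf =>
    rw [fix_eval] at h
    refine PFun.fixInduction (C := fun v => BigStep (fix f) v w) h fun v hv ih => ?_
    rcases PFun.mem_fix_iff.1 hv with h1 | ⟨t, h1, -⟩
    · obtain ⟨x, hx, he⟩ := (Part.mem_map_iff _).1 h1
      split_ifs at he with h0
      cases he
      exact .fix_done (ihf hx) h0
    · obtain ⟨x, hx, he⟩ := (Part.mem_map_iff _).1 h1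
      have := ih t h1
      rcases x with _ | ⟨_ | n, x⟩ <;> simp at he
      subst he
      exact .fix_step (ihf hx) this

/-- An injective numbering of codes. -/
def codeNum : Code → ℕ
  | zero' => Nat.pair 0 0
  | succ => Nat.pair 1 0
  | tail => Nat.pair 2 0
  | cons f g => Nat.pair 3 (Nat.pair (codeNum f) (codeNum g))
  | comp f g => Nat.pair 4 (Nat.pair (codeNum f) (codeNum g))
  | case f g => Nat.pair 5 (Nat.pair (codeNum f) (codeNum g))
  | fix f => Nat.pair 6 (codeNum f)

theorem codeNum_injective : Function.Injective codeNum := by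
  intro c
  induction c with
  | zero' | succ | tail => intro d h; cases d <;> simp_all [codeNum, Nat.pair_eq_pair]
  | cons f g ih ih' | comp f g ih ih' | case f g ih ih' =>
    intro d h
    cases d <;> simp [codeNum, Nat.pair_eq_pair] at h
    rw [ih h.1, ih' h.2]
  | fix f ih =>
    intro d h
    cases d <;> simp [codeNum, Nat.pair_eq_pair] at h
    rw [ih h]

/-- There is a code whose halting problem on singleton inputs is undecidable. -/
theorem exists_code_halting_undecidable :
    ∃ c : Code, ¬ ComputablePred fun n : ℕ => ∃ w, BigStep c [n] w := by
  -- A universal function: the input is a program number, and the program is run on `0`.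
  have hf : Partrec fun n : ℕ => (Nat.Partrec.Code.ofNatCode n).eval 0 :=
    Nat.Partrec.Code.eval_part.comp
      ((Computable.ofNat Nat.Partrec.Code).of_eq fun n => rfl) (Computable.const 0)
  have hf' : Nat.Partrec' fun v : List.Vector ℕ 1 =>
      (Nat.Partrec.Code.ofNatCode v.head).eval 0 := Nat.Partrec'.part_iff₁.2 hf
  obtain ⟨c, hc⟩ := Code.exists_code hf'
  refine ⟨c, fun h => ComputablePred.halting_problem 0 ?_⟩
  refine ComputablePred.computable_of_manyOneReducible
    ⟨Encodable.encode, Computable.encode, fun d => ?_⟩ h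
  have h1 := hc (Encodable.encode d ::ᵥ List.Vector.nil)
  have hd : Nat.Partrec.Code.ofNatCode (Encodable.encode d) = d :=
    Denumerable.ofNat_encode d
  simp only [List.Vector.head_cons, hd] at h1
  have h2 : (c.eval [Encodable.encode d]).Dom ↔ (d.eval 0).Dom := by
    change (c.eval (Encodable.encode d ::ᵥ List.Vector.nil).1).Dom ↔ _
    rw [h1]; rfl
  refine h2.symm.trans (Part.dom_iff_mem.trans ?_)
  exact ⟨fun ⟨w, hw⟩ => ⟨w, .of_mem_eval hw⟩, fun ⟨w, hw⟩ => ⟨w, hw.mem_eval⟩⟩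

end BigStep

/-! ### General facts on transition systems and decidability -/

theorem LTL.holds_always_not_atom {N : ℕ∞} {I : ℕ → Instance} {p : ℕ} :
    (LTL.always (LTL.neg (LTL.atom p))).Holds N I 0 ↔ ∀ j : ℕ, (j : ℕ∞) ≤ N → (p, []) ∉ I j := by
  simp [LTL.always, LTL.eventually, LTL.Holds, LTL.tru]

/-- Deterministic services are a special case of nondeterministic ones. -/
theorem DCDS.ctsNondet_step_of_ctsDet_step {S : DCDS} {s s' : S.ctsDet.State}
    (h : S.ctsDet.step s s') : S.ctsNondet.step s.1 s'.1 := by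
  obtain ⟨α, σ, hl, hx, hs, hc⟩ := h
  -- The default `0` is never used for a call that occurs in this step, since all of these are bound
  -- in the new map.
  refine ⟨α, σ, fun k => (s'.2 k).getD 0, hl, ?_, hc⟩
  rw [hs]
  have key : ∀ g ∈ α.doo s.1 σ,
      g.2.map s'.2.value = g.2.map (CallMap.value fun k => some ((s'.2 k).getD 0)) := by
    intro g hg
    refine List.map_congr_left fun x hxg => ?_
    rcases x with c | k
    · rfl
    · simp only [CallMap.value]
      rcases hk : s.2 k with _ | c
      · obtain ⟨c, hc⟩ := ((hx k).2 hk).1 ⟨g, hg, hxg⟩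
        simp [hc]
      · simp [(hx k).1 c hk]
  ext f
  constructor
  · rintro ⟨g, hg, h1, h2⟩
    exact ⟨g, hg, h1, (key g hg).symm.trans h2⟩
  · rintro ⟨g, hg, h1, h2⟩
    exact ⟨g, hg, h1, (key g hg).trans h2⟩

/-- A sequence of steps in which all service calls are answered by one total function can also be
made with deterministic services. -/
theorem DCDS.exists_ctsDet_run {S : DCDS} {θ : Call → ℕ} {I : ℕ → Instance} {α : Action}
    {σ : ℕ → ℕ} (h0 : I 0 = S.initInst) (hl : ∀ i, S.Legal (I i) α σ)
    (hI : ∀ i, I (i + 1) = CallMap.apply (fun k => some (θ k)) (α.doo (I i) σ))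
    (hc : ∀ i, S.Consistent (I i)) :
    ∃ τ : ℕ → S.ctsDet.State, S.ctsDet.IsMaximalRun ⊤ τ ∧ ∀ i, S.ctsDet.db (τ i) = I i := by
  classical
  -- The map before step `i` is the restriction of `θ` to the calls made so far.
  let M : ℕ → CallMap := fun i => Nat.rec (fun _ => none)
    (fun j m k => if (m k).isSome ∨ k ∈ callsOf (α.doo (I j) σ) then some (θ k) else none) i
  have hM : ∀ j k, M (j + 1) k =
      if (M j k).isSome ∨ k ∈ callsOf (α.doo (I j) σ) then some (θ k) else none := fun _ _ => rfl
  have hθ : ∀ j k c, M j k = some c → c = θ k := by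
    intro j k c h
    cases j with
    | zero => cases h
    | succ j =>
      rw [hM] at h
      split_ifs at h
      exact (Option.some.inj h).symm
  refine ⟨fun i => (I i, M i), ⟨⟨?_, fun i _ => ⟨α, σ, hl i, fun k => ⟨fun c h => ?_, fun h => ?_⟩,
    ?_, hc (i + 1)⟩⟩, fun n hn => by cases hn⟩, fun i => rfl⟩
  · exact Prod.ext h0 rfl
  · change M (i + 1) k = some c
    rw [hM, if_pos (Or.inl (by rw [show M i k = some c from h]; rfl)), hθ i k c h]
  · change _ ↔ ∃ c, M (i + 1) k = some c
    rw [hM, show M i k = none from h]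
    simp
  · change I (i + 1) = (M (i + 1)).apply (α.doo (I i) σ)
    have key : ∀ g ∈ α.doo (I i) σ,
        g.2.map (M (i + 1)).value = g.2.map (CallMap.value fun k => some (θ k)) := by
      intro g hg
      refine List.map_congr_left fun x hxg => ?_
      rcases x with c | k
      · rfl
      · simp only [CallMap.value]
        rw [hM, if_pos (Or.inr ⟨g, hg, hxg⟩)]
    rw [hI]
    ext f
    constructor
    · rintro ⟨g, hg, h1, h2⟩
      exact ⟨g, hg, h1, (key g hg).trans h2⟩
    · rintro ⟨g, hg, h1, h2⟩
      exact ⟨g, hg, h1, (key g hg).symm.trans h2⟩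

/-- A decision procedure for a problem on DCDSs can be applied to all initial instances of one
DCDS. -/
theorem DCDS.isDecidable_withInit {S : DCDS} {Inp Q : DCDS → Prop}
    (h : IsDecidable DCDS.code Inp Q) {Inp' : List Fact → Prop}
    (hInp : ∀ I₀, Inp' I₀ → Inp (S.withInit I₀)) :
    IsDecidable (id : List Fact → List Fact) Inp' fun I₀ => Q (S.withInit I₀) := by
  obtain ⟨P, hP, hPQ⟩ := h
  refine ⟨fun I₀ => P (S.withInit I₀).code, ?_, fun I₀ hI₀ => hPQ _ (hInp I₀ hI₀)⟩
  refine ComputablePred.computable_of_manyOneReducible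
    ⟨fun I₀ => (S.withInit I₀).code, ?_, fun _ => Iff.rfl⟩ hP
  -- The initial instance enters the code verbatim as one component; all other components are
  -- constant.
  exact (Computable.const S.schema).pair
    ((Computable.const (S.constraints.map EqConstraint.code)).pair (Computable.id.pair
    ((Computable.const S.funcs).pair ((Computable.const (S.actions.map Action.code)).pair
      (Computable.const (S.rules.map Rule.code))))))

/-- A many-one reduction of an undecidable predicate to a problem. -/
theorem not_isDecidable_of_reduction {A B : Type} [Primcodable A] [Primcodable B] {p : A → Prop}
    (hp : ¬ ComputablePred p) {Inp Q : B → Prop} {f : A → B} (hf : Computable f)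
    (hInp : ∀ a, Inp (f a)) (hQ : ∀ a, Q (f a) ↔ ¬ p a) :
    ¬ IsDecidable (id : B → B) Inp Q := by
  rintro ⟨P, hP, hPQ⟩
  refine hp ((ComputablePred.computable_of_manyOneReducible ⟨f, hf, fun _ => Iff.rfl⟩ hP).not.of_eq
    fun a => ?_)
  rw [show P (f a) ↔ _ from hPQ _ (hInp a), hQ, not_not]

/-! ### Conjunctions of atoms -/

/-- The conjunction of atoms with the relation symbol `1`. -/
def FO.conj (b : List (List Term)) : FO := b.foldr (fun a φ => .and (.rel 1 a) φ) .tru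

theorem FO.sat_conj {D : Set ℕ} {I : Instance} {b : List (List Term)} {v : ℕ → ℕ} :
    (FO.conj b).Sat D I v ↔ ∀ a ∈ b, ((1, a.map (Term.eval v)) : Fact) ∈ I := by
  induction b with
  | nil => simp [FO.conj, FO.Sat]
  | cons a b ih => simp [FO.conj, FO.Sat] at ih ⊢; simp [ih]

theorem FO.mem_fv_conj {b : List (List Term)} {x : ℕ} :
    x ∈ (FO.conj b).fv ↔ ∃ a ∈ b, ∃ t ∈ a, x ∈ t.fv := by
  induction b with
  | nil => simp [FO.conj, FO.fv]
  | cons a b ih => simp [FO.conj, FO.fv] at ih ⊢; simp [ih]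

theorem FO.mem_consts_conj {b : List (List Term)} {c : ℕ} :
    c ∈ (FO.conj b).consts ↔ ∃ a ∈ b, ∃ t ∈ a, c ∈ t.consts := by
  induction b with
  | nil => simp [FO.conj, FO.consts]
  | cons a b ih => simp [FO.conj, FO.consts] at ih ⊢; simp [ih]

theorem FO.overSchema_conj {schema : List (ℕ × ℕ)} {b : List (List Term)} :
    (FO.conj b).OverSchema schema ↔ ∀ a ∈ b, (1, a.length) ∈ schema := by
  induction b with
  | nil => simp [FO.conj, FO.OverSchema]
  | cons a b ih => simp [FO.conj, FO.OverSchema] at ih ⊢; simp [ih]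

theorem FO.isCQ_conj (b : List (List Term)) : (FO.conj b).IsCQ := by
  induction b with
  | nil => exact .tru
  | cons a b ih => exact .and (.rel 1 a) ih

/-! ### Datalog clauses with service calls in the head -/

/-- A clause: if all atoms of the body (with relation symbol `1`) hold, then so does the head. -/
structure Clause where
  body : List (List Term)
  rel : ℕ
  head : List HeadTerm

namespace Clause

def effect (r : Clause) : Effect := ⟨FO.conj r.body, .tru, [(r.rel, r.head)]⟩

/-- The value of a head term if service calls are answered by `θ`. -/
def headValue (θ : Call → ℕ) (v : ℕ → ℕ) : HeadTerm → ℕ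
  | .plain t => t.eval v
  | .call f args => θ (f, args.map (Term.eval v))

/-- The active-domain condition is automatic: each free variable occurs in a body atom, so its value
occurs in a fact of `I`. -/
theorem fires_iff {r : Clause} {I : Instance} {σ v : ℕ → ℕ} :
    r.effect.Fires [] I σ v ↔ ∀ a ∈ r.body, ((1, a.map (Term.eval v)) : Fact) ∈ I := by
  have hs := @FO.sat_conj
  simp only [Effect.Fires, FO.IsAnswerOn, effect, FO.Sat, hs, and_true]
  refine ⟨fun h => h.2.2, fun h => ⟨by simp, fun x hx => ?_, h⟩⟩
  simp only [FO.fv, Finset.union_empty] at hx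
  obtain ⟨a, ha, t, ht, hx⟩ := FO.mem_fv_conj.1 hx
  refine Or.inl (Or.inl ⟨_, h a ha, List.mem_map.2 ⟨t, ht, ?_⟩⟩)
  cases t with
  | var y => rw [Finset.mem_singleton.1 hx]; rfl
  | const c => cases hx

/-- The instance that the clauses `rs` produce from `I`. -/
def next (rs : List Clause) (θ : Call → ℕ) (I : Instance) : Instance :=
  {f | ∃ r ∈ rs, ∃ v : ℕ → ℕ, (∀ a ∈ r.body, ((1, a.map (Term.eval v)) : Fact) ∈ I) ∧
    f = (r.rel, r.head.map (headValue θ v))}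

/-- The action that applies all clauses in parallel. -/
def action (rs : List Clause) : Action := ⟨0, [], rs.map effect⟩

/-- Grounding a head and then answering its calls is the same as evaluating it with `headValue`;
this removes service calls from the rest of the argument. -/
theorem apply_doo (rs : List Clause) (θ : Call → ℕ) (I : Instance) (σ : ℕ → ℕ) :
    CallMap.apply (fun k => some (θ k)) ((action rs).doo I σ) = next rs θ I := by
  have hv : ∀ v : ℕ → ℕ, (CallMap.value fun k => some (θ k)) ∘ HeadTerm.ground v =
      some ∘ headValue θ v := by
    intro v
    funext t
    cases t <;> rfl
  ext ⟨R, l⟩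
  constructor
  · rintro ⟨g, ⟨e, he, v, hf, h, hh, rfl⟩, h1, h2⟩
    obtain ⟨r, hr, rfl⟩ := List.mem_map.1 he
    obtain rfl : h = (r.rel, r.head) := List.mem_singleton.1 hh
    refine ⟨r, hr, v, fires_iff.1 hf, ?_⟩
    simp only [List.map_map, hv] at h1 h2
    rw [← List.map_map] at h2
    exact Prod.ext h1 ((Option.some_injective _).list_map h2).symm
  · rintro ⟨r, hr, v, hb, h⟩
    obtain ⟨rfl, rfl⟩ := Prod.mk.inj h
    refine ⟨_, ⟨r.effect, List.mem_map.2 ⟨r, hr, rfl⟩, v, fires_iff.2 hb, _,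
      List.mem_singleton.2 rfl, rfl⟩, rfl, ?_⟩
    simp only [List.map_map, hv]

/-- Decidable conditions under which the effect of a clause is admissible in a DCDS with relations
`schema` and functions `funcs`, all of whose constants are below `N`. -/
structure WellFormed (schema funcs : List (ℕ × ℕ)) (N : ℕ) (r : Clause) : Prop where
  body_schema : ∀ a ∈ r.body, (1, a.length) ∈ schema
  body_consts : ∀ a ∈ r.body, ∀ t ∈ a, ∀ c ∈ t.consts, c < N
  head_schema : (r.rel, r.head.length) ∈ schema
  head_funcs : ∀ t ∈ r.head, t.OverFuncs funcs
  head_vars : ∀ t ∈ r.head, ∀ x ∈ t.fv, ∃ a ∈ r.body, ∃ s ∈ a, x ∈ s.fv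
  head_consts : ∀ t ∈ r.head, ∀ c ∈ t.consts, c < N

theorem WellFormed.isEffect {S : DCDS} {N : ℕ} {r : Clause} {P : Finset ℕ}
    (h : r.WellFormed S.schema S.funcs N) (hN : ∀ c < N, c ∈ adom S.initInst) :
    S.IsEffect P r.effect where
  pos := ⟨FO.overSchema_conj.2 h.body_schema, fun c hc => by
    obtain ⟨a, ha, t, ht, hc⟩ := FO.mem_consts_conj.1 hc
    exact hN c (h.body_consts a ha t ht c hc)⟩
  ucq := .cq (FO.isCQ_conj _)
  filter := ⟨trivial, fun c hc => by cases hc⟩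
  filter_vars := Finset.empty_subset _
  head_schema := by simpa [effect] using h.head_schema
  head_funcs := by simpa [effect] using h.head_funcs
  head_vars := by
    simp only [effect, List.mem_singleton, forall_eq]
    exact fun t ht x hx => Finset.mem_union_left _ (FO.mem_fv_conj.2 (h.head_vars t ht x hx))
  head_consts := by
    simp only [effect, List.mem_singleton, forall_eq]
    exact fun t ht c hc => hN c (h.head_consts t ht c hc)

end Clause

/-! ### The interpreter -/

namespace Interp

open Term HeadTerm Clause

/-- The facts of the interpreter, in a single relation with a leading tag. -/
abbrev fact (t a b c : ℕ) : Fact := (1, [t, a, b, c])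

/-- The clauses of the interpreter.  Tag `0` is for the construction of lists: `fact 0 0 _ d`,
`fact 0 1 l d` and `fact 0 2 l d` say that `d` is the empty list, arises from `l` by prepending
`0`, and arises from `l` by incrementing the head.  The tags `1` to `4` are for the relations
`w = head v :: t`, `t = tail v`, `head v = 0` and "the code `c` maps `v` to `w`"; the tags `5` to
`11` describe codes, and `12` the input. -/
def clauses : List Clause :=
  -- An action discards everything that it does not produce, so facts persist only through this
  -- copying clause.
  [⟨[[var 0, var 1, var 2, var 3]], 1, [plain (var 0), plain (var 1), plain (var 2), plain (var 3)]⟩,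
   ⟨[[const 0, var 0, var 1, var 2]], 1,
      [plain (const 0), plain (const 1), plain (var 2), call 0 [var 2]]⟩,
   ⟨[[const 0, const 1, var 1, var 2]], 1,
      [plain (const 0), plain (const 2), plain (var 2), call 1 [var 2]]⟩,
   ⟨[[const 0, const 2, var 1, var 2]], 1,
      [plain (const 0), plain (const 2), plain (var 2), call 1 [var 2]]⟩,
   ⟨[[const 0, const 0, var 1, var 2]], 1,
      -- The empty list counts as having head zero, in agreement with `List.headI`.
      [plain (const 3), plain (var 2), plain (var 2), plain (var 2)]⟩,
   ⟨[[const 0, const 1, var 1, var 2]], 1,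
      [plain (const 3), plain (var 2), plain (var 2), plain (var 2)]⟩,
   ⟨[[const 0, const 0, var 1, var 2]], 1,
      [plain (const 2), plain (var 2), plain (var 2), plain (var 2)]⟩,
   ⟨[[const 0, const 1, var 1, var 2]], 1,
      [plain (const 2), plain (var 2), plain (var 1), plain (var 1)]⟩,
   ⟨[[const 0, const 2, var 1, var 2], [const 2, var 1, var 3, var 3]], 1,
      [plain (const 2), plain (var 2), plain (var 3), plain (var 3)]⟩,
   ⟨[[const 3, var 0, var 0, var 0], [const 0, const 1, var 1, var 2]], 1,
      [plain (const 1), plain (var 0), plain (var 1), plain (var 2)]⟩,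
   ⟨[[const 1, var 0, var 1, var 2], [const 0, const 2, var 0, var 3],
      [const 0, const 2, var 2, var 4]], 1,
      [plain (const 1), plain (var 3), plain (var 1), plain (var 4)]⟩,
   ⟨[[const 5, var 0, var 0, var 0], [const 0, const 1, var 1, var 2]], 1,
      [plain (const 4), plain (var 0), plain (var 1), plain (var 2)]⟩,
   ⟨[[const 6, var 0, var 0, var 0], [const 0, const 0, var 1, var 2],
      [const 1, var 3, var 2, var 4], [const 0, const 2, var 4, var 5]], 1,
      [plain (const 4), plain (var 0), plain (var 3), plain (var 5)]⟩,
   ⟨[[const 7, var 0, var 0, var 0], [const 2, var 1, var 2, var 2]], 1,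
      [plain (const 4), plain (var 0), plain (var 1), plain (var 2)]⟩,
   ⟨[[const 8, var 0, var 1, var 2], [const 4, var 1, var 3, var 4],
      [const 4, var 2, var 3, var 5], [const 1, var 4, var 5, var 6]], 1,
      [plain (const 4), plain (var 0), plain (var 3), plain (var 6)]⟩,
   ⟨[[const 9, var 0, var 1, var 2], [const 4, var 2, var 3, var 4],
      [const 4, var 1, var 4, var 5]], 1,
      [plain (const 4), plain (var 0), plain (var 3), plain (var 5)]⟩,
   ⟨[[const 10, var 0, var 1, var 2], [const 3, var 3, var 3, var 3],
      [const 2, var 3, var 4, var 4], [const 4, var 1, var 4, var 5]], 1,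
      [plain (const 4), plain (var 0), plain (var 3), plain (var 5)]⟩,
   ⟨[[const 10, var 0, var 1, var 2], [const 0, const 2, var 3, var 4],
      [const 4, var 2, var 3, var 5]], 1,
      [plain (const 4), plain (var 0), plain (var 4), plain (var 5)]⟩,
   ⟨[[const 11, var 0, var 1, var 1], [const 4, var 1, var 2, var 3],
      [const 3, var 3, var 3, var 3], [const 2, var 3, var 4, var 4]], 1,
      [plain (const 4), plain (var 0), plain (var 2), plain (var 4)]⟩,
   -- The third atom certifies that the head of the result is nonzero: the result arises by an
   -- increment.
   ⟨[[const 11, var 0, var 1, var 1], [const 4, var 1, var 2, var 3],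
      [const 0, const 2, var 4, var 3], [const 2, var 3, var 5, var 5],
      [const 4, var 0, var 5, var 6]], 1,
      [plain (const 4), plain (var 0), plain (var 2), plain (var 6)]⟩,
   ⟨[[const 12, var 0, var 1, var 1], [const 4, var 0, var 1, var 2]], 0, []⟩]

/-- The immediate consequences of an instance under the clauses of the interpreter. -/
inductive Derives (θ : Call → ℕ) (I : Instance) : Fact → Prop
  | copy {t a b c} : fact t a b c ∈ I → Derives θ I (fact t a b c)
  | push {k l d} : fact 0 k l d ∈ I → Derives θ I (fact 0 1 d (θ (0, [d])))
  | inc_push {l d} : fact 0 1 l d ∈ I → Derives θ I (fact 0 2 d (θ (1, [d])))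
  | inc_inc {l d} : fact 0 2 l d ∈ I → Derives θ I (fact 0 2 d (θ (1, [d])))
  | zero_nil {l d} : fact 0 0 l d ∈ I → Derives θ I (fact 3 d d d)
  | zero_push {l d} : fact 0 1 l d ∈ I → Derives θ I (fact 3 d d d)
  | tail_nil {l d} : fact 0 0 l d ∈ I → Derives θ I (fact 2 d d d)
  | tail_push {l d} : fact 0 1 l d ∈ I → Derives θ I (fact 2 d l l)
  | tail_inc {l d t} : fact 0 2 l d ∈ I → fact 2 l t t ∈ I → Derives θ I (fact 2 d t t)
  | cons_zero {v t w} : fact 3 v v v ∈ I → fact 0 1 t w ∈ I → Derives θ I (fact 1 v t w)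
  | cons_inc {v t w v' w'} : fact 1 v t w ∈ I → fact 0 2 v v' ∈ I → fact 0 2 w w' ∈ I →
      Derives θ I (fact 1 v' t w')
  | eval_zero {c v w} : fact 5 c c c ∈ I → fact 0 1 v w ∈ I → Derives θ I (fact 4 c v w)
  | eval_succ {c l t v w w'} : fact 6 c c c ∈ I → fact 0 0 l t ∈ I → fact 1 v t w ∈ I →
      fact 0 2 w w' ∈ I → Derives θ I (fact 4 c v w')
  | eval_tail {c v t} : fact 7 c c c ∈ I → fact 2 v t t ∈ I → Derives θ I (fact 4 c v t)
  | eval_cons {c a b v x y w} : fact 8 c a b ∈ I → fact 4 a v x ∈ I → fact 4 b v y ∈ I →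
      fact 1 x y w ∈ I → Derives θ I (fact 4 c v w)
  | eval_comp {c a b v x w} : fact 9 c a b ∈ I → fact 4 b v x ∈ I → fact 4 a x w ∈ I →
      Derives θ I (fact 4 c v w)
  | eval_case_zero {c a b v t w} : fact 10 c a b ∈ I → fact 3 v v v ∈ I → fact 2 v t t ∈ I →
      fact 4 a t w ∈ I → Derives θ I (fact 4 c v w)
  | eval_case_succ {c a b v v' w} : fact 10 c a b ∈ I → fact 0 2 v v' ∈ I → fact 4 b v w ∈ I →
      Derives θ I (fact 4 c v' w)
  | eval_fix_done {c a v x w} : fact 11 c a a ∈ I → fact 4 a v x ∈ I → fact 3 x x x ∈ I →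
      fact 2 x w w ∈ I → Derives θ I (fact 4 c v w)
  | eval_fix_step {c a v x y t w} : fact 11 c a a ∈ I → fact 4 a v x ∈ I → fact 0 2 y x ∈ I →
      fact 2 x t t ∈ I → fact 4 c t w ∈ I → Derives θ I (fact 4 c v w)
  | halted {c v w} : fact 12 c v v ∈ I → fact 4 c v w ∈ I → Derives θ I (0, [])

/-- The valuation that maps the first variables to the entries of a list. -/
def env (l : List ℕ) (i : ℕ) : ℕ := l.getD i 0

theorem mem_next_iff {θ : Call → ℕ} {I : Instance} {f : Fact} :
    f ∈ next clauses θ I ↔ Derives θ I f := by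
  constructor
  · rintro ⟨r, hr, v, hb, rfl⟩
    simp only [clauses, List.mem_cons, List.not_mem_nil, or_false] at hr
    rcases hr with rfl | rfl | rfl | rfl | rfl | rfl | rfl | rfl | rfl | rfl | rfl | rfl | rfl |
      rfl | rfl | rfl | rfl | rfl | rfl | rfl | rfl <;>
    simp only [List.forall_mem_cons, List.map_cons, List.map_nil, Term.eval] at hb
    · exact .copy hb.1
    · exact .push hb.1
    · exact .inc_push hb.1
    · exact .inc_inc hb.1
    · exact .zero_nil hb.1
    · exact .zero_push hb.1
    · exact .tail_nil hb.1
    · exact .tail_push hb.1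
    · exact .tail_inc hb.1 hb.2.1
    · exact .cons_zero hb.1 hb.2.1
    · exact .cons_inc hb.1 hb.2.1 hb.2.2.1
    · exact .eval_zero hb.1 hb.2.1
    · exact .eval_succ hb.1 hb.2.1 hb.2.2.1 hb.2.2.2.1
    · exact .eval_tail hb.1 hb.2.1
    · exact .eval_cons hb.1 hb.2.1 hb.2.2.1 hb.2.2.2.1
    · exact .eval_comp hb.1 hb.2.1 hb.2.2.1
    · exact .eval_case_zero hb.1 hb.2.1 hb.2.2.1 hb.2.2.2.1
    · exact .eval_case_succ hb.1 hb.2.1 hb.2.2.1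
    · exact .eval_fix_done hb.1 hb.2.1 hb.2.2.1 hb.2.2.2.1
    · exact .eval_fix_step hb.1 hb.2.1 hb.2.2.1 hb.2.2.2.1 hb.2.2.2.2.1
    · exact .halted hb.1 hb.2.1
  · have key : ∀ (i : ℕ) (hi : i < clauses.length) (l : List ℕ),
        (∀ a ∈ clauses[i].body, ((1, a.map (Term.eval (env l))) : Fact) ∈ I) →
        (clauses[i].rel, clauses[i].head.map (headValue θ (env l))) ∈ next clauses θ I :=
      fun i hi l hb => ⟨_, List.getElem_mem hi, env l, hb, rfl⟩
    intro h
    cases h with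
    | @copy t a b c h => exact key 0 (by decide) [t, a, b, c] (by simpa [clauses] using! h)
    | @push k l d h => exact key 1 (by decide) [k, l, d] (by simpa [clauses] using! h)
    -- Clauses in which `var 0` does not occur receive a dummy first entry.
    | @inc_push l d h => exact key 2 (by decide) [0, l, d] (by simpa [clauses] using! h)
    | @inc_inc l d h => exact key 3 (by decide) [0, l, d] (by simpa [clauses] using! h)
    | @zero_nil l d h => exact key 4 (by decide) [0, l, d] (by simpa [clauses] using! h)
    | @zero_push l d h => exact key 5 (by decide) [0, l, d] (by simpa [clauses] using! h)
    | @tail_nil l d h => exact key 6 (by decide) [0, l, d] (by simpa [clauses] using! h)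
    | @tail_push l d h => exact key 7 (by decide) [0, l, d] (by simpa [clauses] using! h)
    | @tail_inc l d t h h' =>
      exact key 8 (by decide) [0, l, d, t] (by simpa [clauses] using! ⟨h, h'⟩)
    | @cons_zero v t w h h' =>
      exact key 9 (by decide) [v, t, w] (by simpa [clauses] using! ⟨h, h'⟩)
    | @cons_inc v t w v' w' h h1 h2 =>
      exact key 10 (by decide) [v, t, w, v', w'] (by simpa [clauses] using! ⟨h, h1, h2⟩)
    | @eval_zero c v w h h' =>
      exact key 11 (by decide) [c, v, w] (by simpa [clauses] using! ⟨h, h'⟩)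
    | @eval_succ c l t v w w' h h1 h2 h3 =>
      exact key 12 (by decide) [c, l, t, v, w, w'] (by simpa [clauses] using! ⟨h, h1, h2, h3⟩)
    | @eval_tail c v t h h' =>
      exact key 13 (by decide) [c, v, t] (by simpa [clauses] using! ⟨h, h'⟩)
    | @eval_cons c a b v x y w h h1 h2 h3 =>
      exact key 14 (by decide) [c, a, b, v, x, y, w] (by simpa [clauses] using! ⟨h, h1, h2, h3⟩)
    | @eval_comp c a b v x w h h1 h2 =>
      exact key 15 (by decide) [c, a, b, v, x, w] (by simpa [clauses] using! ⟨h, h1, h2⟩)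
    | @eval_case_zero c a b v t w h h1 h2 h3 =>
      exact key 16 (by decide) [c, a, b, v, t, w] (by simpa [clauses] using! ⟨h, h1, h2, h3⟩)
    | @eval_case_succ c a b v v' w h h1 h2 =>
      exact key 17 (by decide) [c, a, b, v, v', w] (by simpa [clauses] using! ⟨h, h1, h2⟩)
    | @eval_fix_done c a v x w h h1 h2 h3 =>
      exact key 18 (by decide) [c, a, v, x, w] (by simpa [clauses] using! ⟨h, h1, h2, h3⟩)
    | @eval_fix_step c a v x y t w h h1 h2 h3 h4 =>
      exact key 19 (by decide) [c, a, v, x, y, t, w]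
        (by simpa [clauses] using! ⟨h, h1, h2, h3, h4⟩)
    | @halted c v w h h' =>
      exact key 20 (by decide) [c, v, w] (by simpa [clauses] using! ⟨h, h'⟩)

/-- The relations and the functions of the interpreter. -/
abbrev relations : List (ℕ × ℕ) := [(0, 0), (1, 4)]
abbrev functions : List (ℕ × ℕ) := [(0, 1), (1, 1)]

theorem clauses_wellFormed : ∀ r ∈ clauses, r.WellFormed relations functions 14 := by
  intro r hr
  have h1 : ∀ r ∈ clauses, ∀ a ∈ r.body, (1, a.length) ∈ relations := by decide
  have h2 : ∀ r ∈ clauses, ∀ a ∈ r.body, ∀ t ∈ a, ∀ c ∈ t.consts, c < 14 := by decide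
  have h3 : ∀ r ∈ clauses, (r.rel, r.head.length) ∈ relations := by decide
  have h4 : ∀ r ∈ clauses, ∀ t ∈ r.head, t.OverFuncs functions := by
    simp [clauses, HeadTerm.OverFuncs]
  have h5 : ∀ r ∈ clauses, ∀ t ∈ r.head, ∀ x ∈ t.fv, ∃ a ∈ r.body, ∃ s ∈ a, x ∈ s.fv := by decide
  have h6 : ∀ r ∈ clauses, ∀ t ∈ r.head, ∀ c ∈ t.consts, c < 14 := by decide
  exact ⟨h1 r hr, h2 r hr, h3 r hr, h4 r hr, h5 r hr, h6 r hr⟩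

/-! ### The guard and the transitions of the interpreter -/

/-- The construction of lists is unambiguous. -/
def Good (I : Instance) : Prop :=
  ∀ k l k' l' d, fact 0 k l d ∈ I → fact 0 k' l' d ∈ I → k = k' ∧ l = l'

/-- The guard of the interpreter: a sentence that expresses `Good`. -/
def guard : FO :=
  .neg (.ex 0 (.ex 1 (.ex 2 (.ex 3 (.ex 4
    (.and (.rel 1 [const 0, var 0, var 1, var 4])
      (.and (.rel 1 [const 0, var 2, var 3, var 4])
        (.neg (.and (.eq (var 0) (var 2)) (.eq (var 1) (var 3)))))))))))

theorem guard_fv : guard.fv = ∅ := by decide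

theorem guard_consts : guard.consts = {0} := by decide

/-- Quantifying over the active domain loses nothing, because any counterexample to `Good` consists
of values occurring in facts. -/
theorem isAnswer_guard_iff {I : Instance} {v : ℕ → ℕ} : guard.IsAnswer I v ↔ Good I := by
  have hD : ∀ f ∈ I, ∀ c ∈ f.2, c ∈ guard.evalDom I := fun f hf c hc => Or.inl ⟨f, hf, hc⟩
  rw [FO.IsAnswer, FO.IsAnswerOn, guard_fv]
  generalize guard.evalDom I = D at hD
  simp only [Finset.notMem_empty, IsEmpty.forall_iff, implies_true, true_and, guard, FO.Sat,
    List.map_cons, List.map_nil, Term.eval, Function.update_apply]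
  norm_num
  constructor
  · intro h k l k' l' d h1 h2
    exact h k (hD _ h1 _ (by simp)) l (hD _ h1 _ (by simp)) k' (hD _ h2 _ (by simp)) l'
      (hD _ h2 _ (by simp)) d (hD _ h2 _ (by simp)) h1 h2
  · intro h k _ l _ k' _ l' _ d _ h1 h2
    exact h k l k' l' d h1 h2

/-- The interpreter with initial instance `I₀`. -/
def system (I₀ : List Fact) : DCDS where
  schema := relations
  constraints := []
  init := I₀
  funcs := functions
  actions := [action clauses]
  rules := [⟨guard, 0⟩]

theorem system_isValid {I₀ : List Fact} (h : ∀ f ∈ I₀, (f.1, f.2.length) ∈ relations)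
    (hc : ∀ c < 14, c ∈ adom (system I₀).initInst) : (system I₀).IsValid where
  schema_names := by simp [system]
  func_names := by simp [system]
  action_names := by simp [system]
  init_conforms := h
  constraints := by simp [system]
  init_consistent := by simp [DCDS.Consistent, system]
  params := by simp [system, action]
  effects := by
    intro α hα e he
    obtain rfl : α = action clauses := List.mem_singleton.1 hα
    obtain ⟨r, hr, rfl⟩ := List.mem_map.1 he
    exact (clauses_wellFormed r hr).isEffect hc
  rule_query := by
    intro r hr
    obtain rfl : r = ⟨guard, 0⟩ := List.mem_singleton.1 hr
    refine ⟨by simp [guard, FO.OverSchema, system], fun c h => ?_⟩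
    rw [guard_consts, Finset.mem_singleton] at h
    exact hc c (by omega)
  rule_action := by
    intro r hr
    obtain rfl : r = ⟨guard, 0⟩ := List.mem_singleton.1 hr
    exact ⟨action clauses, List.mem_singleton.2 rfl, rfl, guard_fv⟩

theorem legal_iff {I₀ : List Fact} {I : Instance} {α : Action} {σ : ℕ → ℕ} :
    (system I₀).Legal I α σ ↔ α = action clauses ∧ Good I := by
  constructor
  · rintro ⟨hα, r, hr, -, h⟩
    obtain rfl : r = ⟨guard, 0⟩ := List.mem_singleton.1 hr
    exact ⟨List.mem_singleton.1 hα, isAnswer_guard_iff.1 h⟩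
  · rintro ⟨rfl, h⟩
    exact ⟨List.mem_singleton.2 rfl, ⟨guard, 0⟩, List.mem_singleton.2 rfl, rfl,
      isAnswer_guard_iff.2 h⟩

theorem consistent (I₀ : List Fact) (I : Instance) : (system I₀).Consistent I := by
  simp [DCDS.Consistent, system]

theorem ctsNondet_step_iff {I₀ : List Fact} {I I' : Instance} :
    (system I₀).ctsNondet.step I I' ↔ Good I ∧ ∃ θ, I' = next clauses θ I := by
  constructor
  · rintro ⟨α, σ, θ, hl, rfl, -⟩
    obtain ⟨rfl, hg⟩ := legal_iff.1 hl
    exact ⟨hg, θ, apply_doo _ _ _ _⟩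
  · rintro ⟨hg, θ, rfl⟩
    exact ⟨action clauses, fun _ => 0, θ, legal_iff.2 ⟨rfl, hg⟩, (apply_doo _ _ _ _).symm,
      consistent _ _⟩

end Interp

namespace Interp

open Turing.ToPartrec Clause

theorem fact_inj {t a b c t' a' b' c' : ℕ} :
    fact t a b c = fact t' a' b' c' ↔ t = t' ∧ a = a' ∧ b = b' ∧ c = c' := by
  simp

/-! ### Soundness -/

/-- The constant `d` stands for a list of numbers in `I`. -/
inductive Rep (I : Instance) : ℕ → List ℕ → Prop
  | nil {l d} : fact 0 0 l d ∈ I → Rep I d []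
  | push {l d v} : fact 0 1 l d ∈ I → Rep I l v → Rep I d (0 :: v)
  | inc {l d n v} : fact 0 2 l d ∈ I → Rep I l (n :: v) → Rep I d ((n + 1) :: v)

theorem Rep.mono {I J : Instance} (h : ∀ k l d, fact 0 k l d ∈ I → fact 0 k l d ∈ J) {d : ℕ}
    {v : List ℕ} (hd : Rep I d v) : Rep J d v := by
  induction hd with
  | nil h' => exact .nil (h _ _ _ h')
  | push h' _ ih => exact .push (h _ _ _ h') ih
  | inc h' _ ih => exact .inc (h _ _ _ h') ih

/-- In a good instance the last construction step of a constant is determined, so its list can be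
read off recursively. -/
theorem Rep.unique {I : Instance} (hI : Good I) {d : ℕ} {v w : List ℕ} (hv : Rep I d v)
    (hw : Rep I d w) : v = w := by
  induction hv generalizing w with
  | nil h =>
    cases hw with
    | nil => rfl
    | push h' | inc h' => exact absurd (hI _ _ _ _ _ h h').1 (by decide)
  | push h _ ih =>
    cases hw with
    | push h' hw => obtain ⟨-, rfl⟩ := hI _ _ _ _ _ h h'; rw [ih hw]
    | nil h' | inc h' => exact absurd (hI _ _ _ _ _ h h').1 (by decide)
  | inc h _ ih =>
    cases hw with
    | inc h' hw =>
      obtain ⟨-, rfl⟩ := hI _ _ _ _ _ h h'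
      cases ih hw
      rfl
    | nil h' | push h' => exact absurd (hI _ _ _ _ _ h h').1 (by decide)

/-- The meaning of the facts of the interpreter for the code `C` and the input `[n]`, where `R`
relates constants to the lists that they stand for. -/
def Sound (C : Code) (n : ℕ) (R : ℕ → List ℕ → Prop) : ℕ → ℕ → ℕ → ℕ → Prop
  -- Nothing is demanded of the constructed constant: the fact itself makes it stand for a list as
  -- soon as `l` does.
  | 0, k, l, _ => k = 0 ∨ (k = 1 ∧ ∃ v, R l v) ∨ (k = 2 ∧ ∃ m v, R l (m :: v))
  | 1, a, b, d => ∃ v t, R a v ∧ R b t ∧ R d (v.headI :: t)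
  | 2, a, b, _ => ∃ v, R a v ∧ R b v.tail
  | 3, a, _, _ => ∃ v, R a v ∧ v.headI = 0
  | 4, c, a, b => ∃ x v w, c = codeNum x ∧ R a v ∧ R b w ∧ BigStep x v w
  | 5, c, _, _ => c = codeNum .zero'
  | 6, c, _, _ => c = codeNum .succ
  | 7, c, _, _ => c = codeNum .tail
  | 8, c, a, b => ∃ x y, c = codeNum (.cons x y) ∧ a = codeNum x ∧ b = codeNum y
  | 9, c, a, b => ∃ x y, c = codeNum (.comp x y) ∧ a = codeNum x ∧ b = codeNum y
  | 10, c, a, b => ∃ x y, c = codeNum (.case x y) ∧ a = codeNum x ∧ b = codeNum y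
  | 11, c, a, _ => ∃ x, c = codeNum (.fix x) ∧ a = codeNum x
  | 12, c, a, _ => c = codeNum C ∧ R a [n]
  | _, _, _, _ => True

/-- Representations occur only positively, so soundness survives the growth of the instance. -/
theorem Sound.mono {C : Code} {n : ℕ} {R R' : ℕ → List ℕ → Prop} (h : ∀ d v, R d v → R' d v)
    {t a b c : ℕ} (hs : Sound C n R t a b c) : Sound C n R' t a b c := by
  unfold Sound at hs ⊢
  split at hs
  · rcases hs with hk | ⟨hk, v, hv⟩ | ⟨hk, m, v, hv⟩
    · exact Or.inl hk
    · exact Or.inr (Or.inl ⟨hk, v, h _ _ hv⟩)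
    · exact Or.inr (Or.inr ⟨hk, m, v, h _ _ hv⟩)
  · obtain ⟨v, t, h1, h2, h3⟩ := hs
    exact ⟨v, t, h _ _ h1, h _ _ h2, h _ _ h3⟩
  · obtain ⟨v, h1, h2⟩ := hs
    exact ⟨v, h _ _ h1, h _ _ h2⟩
  · obtain ⟨v, h1, h2⟩ := hs
    exact ⟨v, h _ _ h1, h2⟩
  · obtain ⟨x, v, w, h0, h1, h2, h3⟩ := hs
    exact ⟨x, v, w, h0, h _ _ h1, h _ _ h2, h3⟩
  all_goals first | exact hs | exact ⟨hs.1, h _ _ hs.2⟩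

/-- All facts of the instance are sound, and `halted` is only true if the code halts. -/
def SoundInst (C : Code) (n : ℕ) (I : Instance) : Prop :=
  (∀ t a b c, fact t a b c ∈ I → Sound C n (Rep I) t a b c) ∧
    (((0, []) : Fact) ∈ I → ∃ w, BigStep C [n] w)

/-- `Good` is needed wherever two premises share a constant: by uniqueness both speak of the same
list, and injectivity of `codeNum` does the same for codes. The new fact is sound already with
respect to the representations in the old instance, whatever the services answered. -/
theorem Derives.sound {C : Code} {n : ℕ} {θ : Call → ℕ} {I : Instance} (hI : Good I)
    (hs : SoundInst C n I) {t a b c : ℕ} (h : Derives θ I (fact t a b c)) :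
    Sound C n (Rep I) t a b c := by
  have S : ∀ {t a b c}, fact t a b c ∈ I → Sound C n (Rep I) t a b c := hs.1 _ _ _ _
  have rep : ∀ {k l d}, fact 0 k l d ∈ I → ∃ v, Rep I d v := by
    intro k l d h
    rcases S h with rfl | ⟨rfl, v, hv⟩ | ⟨rfl, m, v, hv⟩
    · exact ⟨_, .nil h⟩
    · exact ⟨_, .push h hv⟩
    · exact ⟨_, .inc h hv⟩
  have rep1 : ∀ {l d}, fact 0 1 l d ∈ I → ∃ v, Rep I l v ∧ Rep I d (0 :: v) := by
    intro l d h
    rcases S h with h0 | ⟨-, v, hv⟩ | ⟨h0, -⟩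
    · cases h0
    · exact ⟨v, hv, .push h hv⟩
    · cases h0
  have rep2 : ∀ {l d}, fact 0 2 l d ∈ I →
      ∃ m v, Rep I l (m :: v) ∧ Rep I d ((m + 1) :: v) := by
    intro l d h
    rcases S h with h0 | ⟨h0, -⟩ | ⟨-, m, v, hv⟩
    · cases h0
    · cases h0
    · exact ⟨m, v, hv, .inc h hv⟩
  have uniq : ∀ {d v w}, Rep I d v → Rep I d w → v = w := Rep.unique hI
  cases h with
  | copy h => exact S h
  | push h => exact Or.inr (Or.inl ⟨rfl, rep h⟩)
  | inc_push h =>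
    obtain ⟨v, -, hv⟩ := rep1 h
    exact Or.inr (Or.inr ⟨rfl, _, _, hv⟩)
  | inc_inc h =>
    obtain ⟨m, v, -, hv⟩ := rep2 h
    exact Or.inr (Or.inr ⟨rfl, _, _, hv⟩)
  | zero_nil h => exact ⟨_, .nil h, rfl⟩
  | zero_push h =>
    obtain ⟨v, -, hv⟩ := rep1 h
    exact ⟨_, hv, rfl⟩
  | tail_nil h => exact ⟨_, .nil h, .nil h⟩
  | tail_push h =>
    obtain ⟨v, hl, hv⟩ := rep1 h
    exact ⟨_, hv, hl⟩
  | tail_inc h h' =>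
    obtain ⟨m, v, hl, hv⟩ := rep2 h
    obtain ⟨u, hu, ht⟩ := S h'
    cases uniq hl hu
    exact ⟨_, hv, ht⟩
  | cons_zero h h' =>
    obtain ⟨v, hv, h0⟩ := S h
    obtain ⟨t, ht, hw⟩ := rep1 h'
    exact ⟨v, t, hv, ht, by rwa [h0]⟩
  | cons_inc h h1 h2 =>
    obtain ⟨v, t, hv, ht, hw⟩ := S h
    obtain ⟨m, u, hl, hu⟩ := rep2 h1
    obtain ⟨m', u', hl', hu'⟩ := rep2 h2
    cases uniq hl hv
    cases uniq hl' hw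
    exact ⟨_, t, hu, ht, hu'⟩
  | eval_zero h h' =>
    obtain ⟨v, hv, hw⟩ := rep1 h'
    exact ⟨.zero', v, _, S h, hv, hw, .zero' v⟩
  | eval_succ h h1 h2 h3 =>
    obtain ⟨v, t, hv, ht, hw⟩ := S h2
    obtain ⟨m, u, hl, hu⟩ := rep2 h3
    cases uniq hl hw
    cases uniq ht (.nil h1)
    exact ⟨.succ, v, _, S h, hv, hu, .succ v⟩
  | eval_tail h h' =>
    obtain ⟨v, hv, ht⟩ := S h'
    exact ⟨.tail, v, _, S h, hv, ht, .tail v⟩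
  | eval_cons h h1 h2 h3 =>
    obtain ⟨f, g, rfl, rfl, rfl⟩ := S h
    obtain ⟨f', v, x, hf, hv, hx, hb⟩ := S h1
    obtain ⟨g', v', y, hg, hv', hy, hb'⟩ := S h2
    obtain ⟨x', y', hx', hy', hw⟩ := S h3
    cases codeNum_injective hf
    cases codeNum_injective hg
    cases uniq hv hv'
    cases uniq hx hx'
    cases uniq hy hy'
    exact ⟨_, v, _, rfl, hv, hw, .cons hb hb'⟩
  | eval_comp h h1 h2 =>
    obtain ⟨f, g, rfl, rfl, rfl⟩ := S h
    obtain ⟨g', v, x, hg, hv, hx, hb⟩ := S h1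
    obtain ⟨f', x', w, hf, hx', hw, hb'⟩ := S h2
    cases codeNum_injective hf
    cases codeNum_injective hg
    cases uniq hx hx'
    exact ⟨_, v, w, rfl, hv, hw, .comp hb hb'⟩
  | eval_case_zero h h1 h2 h3 =>
    obtain ⟨f, g, rfl, rfl, rfl⟩ := S h
    obtain ⟨v, hv, h0⟩ := S h1
    obtain ⟨v', hv', ht⟩ := S h2
    obtain ⟨f', t, w, hf, ht', hw, hb⟩ := S h3
    cases codeNum_injective hf
    cases uniq hv hv'
    cases uniq ht ht'
    exact ⟨_, v, w, rfl, hv, hw, .case_zero h0 hb⟩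
  | eval_case_succ h h1 h2 =>
    obtain ⟨f, g, rfl, rfl, rfl⟩ := S h
    obtain ⟨m, u, hl, hu⟩ := rep2 h1
    obtain ⟨g', v, w, hg, hv, hw, hb⟩ := S h2
    cases codeNum_injective hg
    cases uniq hl hv
    exact ⟨_, _, w, rfl, hu, hw, .case_succ hb⟩
  | eval_fix_done h h1 h2 h3 =>
    obtain ⟨f, rfl, rfl⟩ := S h
    obtain ⟨f', v, x, hf, hv, hx, hb⟩ := S h1
    obtain ⟨x', hx', h0⟩ := S h2
    obtain ⟨x'', hx'', hw⟩ := S h3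
    cases codeNum_injective hf
    cases uniq hx hx'
    cases uniq hx hx''
    exact ⟨_, v, _, rfl, hv, hw, .fix_done hb h0⟩
  | eval_fix_step h h1 h2 h3 h4 =>
    obtain ⟨f, rfl, rfl⟩ := S h
    obtain ⟨f', v, x, hf, hv, hx, hb⟩ := S h1
    obtain ⟨m, u, -, hu⟩ := rep2 h2
    obtain ⟨x', hx', ht⟩ := S h3
    obtain ⟨g, t, w, hg, ht', hw, hb'⟩ := S h4
    cases codeNum_injective hf
    cases codeNum_injective hg
    cases uniq hx hx'
    cases uniq hu hx
    cases uniq ht ht'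
    exact ⟨_, v, w, rfl, hv, hw, .fix_step hb hb'⟩

/-- The successor need not be good. If it is not, no further step is possible, so nothing more is
required of it. -/
theorem SoundInst.next {C : Code} {n : ℕ} {θ : Call → ℕ} {I : Instance} (hI : Good I)
    (hs : SoundInst C n I) : SoundInst C n (next clauses θ I) := by
  refine ⟨fun t a b c h => ?_, fun h => ?_⟩
  · refine (Derives.sound hI hs (mem_next_iff.1 h)).mono fun d v => Rep.mono fun k l d h => ?_
    exact mem_next_iff.2 (.copy h)
  · have h := mem_next_iff.1 h
    cases h with | halted h1 h2 => ?_
    obtain ⟨rfl, hv⟩ := hs.1 _ _ _ _ h1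
    obtain ⟨x, v, w, hx, hv', -, hb⟩ := hs.1 _ _ _ _ h2
    cases codeNum_injective hx
    cases Rep.unique hI hv hv'
    exact ⟨w, hb⟩

/-! ### Completeness -/

/-- The canonical constant for a list. -/
abbrev enc (v : List ℕ) : ℕ := Encodable.encode v

/-- Increment the head of a list. -/
def incHead : List ℕ → List ℕ
  | [] => []
  | m :: v => (m + 1) :: v

/-- Service results that are canonical constants. -/
def canonicalCall (k : Call) : ℕ :=
  let v : List ℕ := (Encodable.decode k.2.headI).getD []
  if k.1 = 0 then enc (0 :: v) else enc (incHead v)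

theorem canonicalCall_zero (v : List ℕ) : canonicalCall (0, [enc v]) = enc (0 :: v) := by
  simp [canonicalCall]

theorem canonicalCall_one (v : List ℕ) : canonicalCall (1, [enc v]) = enc (incHead v) := by
  simp [canonicalCall]

/-- All lists are constructed from canonical constants. -/
def Canonical (I : Instance) : Prop :=
  ∀ k l d, fact 0 k l d ∈ I → (k = 0 ∧ l = 0 ∧ d = enc []) ∨
    (k = 1 ∧ ∃ v, l = enc v ∧ d = enc (0 :: v)) ∨
    (k = 2 ∧ ∃ m v, l = enc (m :: v) ∧ d = enc ((m + 1) :: v))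

/-- The encoding is injective, and a list determines whether it is empty, has head `0` or has a
positive head, as well as its predecessor. -/
theorem Canonical.good {I : Instance} (h : Canonical I) : Good I := by
  intro k l k' l' d h1 h2
  have inj : ∀ {v w : List ℕ}, enc v = enc w ↔ v = w := Encodable.encode_inj
  rcases h _ _ _ h1 with ⟨rfl, rfl, rfl⟩ | ⟨rfl, v, rfl, rfl⟩ | ⟨rfl, m, v, rfl, rfl⟩ <;>
  rcases h _ _ _ h2 with ⟨rfl, rfl, h⟩ | ⟨rfl, v', rfl, h⟩ | ⟨rfl, m', v', rfl, h⟩ <;>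
  rw [inj] at h <;> simp_all

theorem Canonical.next {I : Instance} (h : Canonical I) :
    Canonical (next clauses canonicalCall I) := by
  intro k l d hd
  have hd := mem_next_iff.1 hd
  cases hd with
  | copy h' => exact h _ _ _ h'
  | push h' =>
    obtain ⟨v, rfl⟩ : ∃ v, l = enc v := by
      rcases h _ _ _ h' with ⟨-, -, h⟩ | ⟨-, v, -, h⟩ | ⟨-, m, v, -, h⟩ <;> exact ⟨_, h⟩
    exact Or.inr (Or.inl ⟨rfl, v, rfl, canonicalCall_zero v⟩)
  | inc_push h' =>
    rcases h _ _ _ h' with ⟨h0, -⟩ | ⟨-, v, -, rfl⟩ | ⟨h0, -⟩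
    · cases h0
    · exact Or.inr (Or.inr ⟨rfl, _, _, rfl, canonicalCall_one _⟩)
    · cases h0
  | inc_inc h' =>
    rcases h _ _ _ h' with ⟨h0, -⟩ | ⟨h0, -⟩ | ⟨-, m, v, -, rfl⟩
    · cases h0
    · cases h0
    · exact Or.inr (Or.inr ⟨rfl, _, _, rfl, canonicalCall_one _⟩)

/-- The `i`-th instance of the run with canonical service results. -/
def canonicalRun (I : Instance) (i : ℕ) : Instance := (next clauses canonicalCall)^[i] I

theorem canonicalRun_succ (I : Instance) (i : ℕ) :
    canonicalRun I (i + 1) = next clauses canonicalCall (canonicalRun I i) :=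
  Function.iterate_succ_apply' _ _ _

theorem Canonical.canonicalRun {I : Instance} (h : Canonical I) (i : ℕ) :
    Canonical (canonicalRun I i) := by
  induction i with
  | zero => exact h
  | succ i ih => rw [canonicalRun_succ]; exact ih.next

/-- The facts that occur in the canonical run. -/
def limit (I : Instance) : Instance := {f | ∃ i, f ∈ canonicalRun I i}

theorem canonicalRun_mono {I : Instance} {t a b c i j : ℕ} (hij : i ≤ j)
    (h : fact t a b c ∈ canonicalRun I i) : fact t a b c ∈ canonicalRun I j := by
  induction j, hij using Nat.le_induction with
  | base => exact h
  | succ j _ ih => rw [canonicalRun_succ]; exact mem_next_iff.2 (.copy ih)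

/-- A body has finitely many atoms, and copied facts persist, so all premises hold together at some
stage; the conclusion appears one step later. -/
theorem mem_limit_of_derives {I : Instance} {f : Fact} (h : Derives canonicalCall (limit I) f) :
    f ∈ limit I := by
  obtain ⟨r, hr, v, hb, rfl⟩ := mem_next_iff.2 h
  -- The length condition matters because only facts of the relation with four arguments are copied;
  -- `halted` is not.
  have key : ∀ b : List (List Term), (∀ a ∈ b, a.length = 4) →
      (∀ a ∈ b, ((1, a.map (Term.eval v)) : Fact) ∈ limit I) →
      ∃ i, ∀ a ∈ b, ((1, a.map (Term.eval v)) : Fact) ∈ canonicalRun I i := by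
    intro b
    induction b with
    | nil => exact fun _ _ => ⟨0, by simp⟩
    | cons a b ih =>
      intro hl hm
      rw [List.forall_mem_cons] at hl hm
      obtain ⟨i, hi⟩ := ih hl.2 hm.2
      obtain ⟨j, hj⟩ := hm.1
      have mono : ∀ {a : List Term} {i j : ℕ}, a.length = 4 → i ≤ j →
          ((1, a.map (Term.eval v)) : Fact) ∈ canonicalRun I i →
          ((1, a.map (Term.eval v)) : Fact) ∈ canonicalRun I j := by
        intro a i j ha hij h
        obtain ⟨t, x, y, z, rfl⟩ := List.length_eq_four.1 ha
        exact canonicalRun_mono hij h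
      refine ⟨max i j, List.forall_mem_cons.2 ⟨mono hl.1 (le_max_right _ _) hj, fun a ha => ?_⟩⟩
      exact mono (hl.2 a ha) (le_max_left _ _) (hi a ha)
  obtain ⟨i, hi⟩ := key r.body (fun a ha => by
    simpa using (clauses_wellFormed r hr).body_schema a ha) hb
  exact ⟨i + 1, by rw [canonicalRun_succ]; exact ⟨r, hr, v, hi, rfl⟩⟩

/-- The facts that describe a code and its parts. -/
def codeFacts : Code → List Fact
  | .zero' => [fact 5 (codeNum .zero') (codeNum .zero') (codeNum .zero')]
  | .succ => [fact 6 (codeNum .succ) (codeNum .succ) (codeNum .succ)]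
  | .tail => [fact 7 (codeNum .tail) (codeNum .tail) (codeNum .tail)]
  | .cons f g => fact 8 (codeNum (.cons f g)) (codeNum f) (codeNum g) ::
      (codeFacts f ++ codeFacts g)
  | .comp f g => fact 9 (codeNum (.comp f g)) (codeNum f) (codeNum g) ::
      (codeFacts f ++ codeFacts g)
  | .case f g => fact 10 (codeNum (.case f g)) (codeNum f) (codeNum g) ::
      (codeFacts f ++ codeFacts g)
  | .fix f => fact 11 (codeNum (.fix f)) (codeNum f) (codeNum f) :: codeFacts f

/-- The lists and the auxiliary relations on them in the limit of the canonical run. -/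
structure ListFacts (L : Instance) : Prop where
  nil : fact 0 0 0 (enc []) ∈ L
  push (v : List ℕ) : fact 0 1 (enc v) (enc (0 :: v)) ∈ L
  inc (m : ℕ) (v : List ℕ) : fact 0 2 (enc (m :: v)) (enc ((m + 1) :: v)) ∈ L
  zero (v : List ℕ) : v.headI = 0 → fact 3 (enc v) (enc v) (enc v) ∈ L
  tail (v : List ℕ) : fact 2 (enc v) (enc v.tail) (enc v.tail) ∈ L
  cons (v t : List ℕ) : fact 1 (enc v) (enc t) (enc (v.headI :: t)) ∈ L

/-- Every list arises from the empty one by prepending `0` and incrementing the head; tails, zero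
tests and the relation for `cons` follow the same recursion. -/
theorem listFacts_limit {I : Instance} (h0 : fact 0 0 0 (enc []) ∈ limit I) :
    ListFacts (limit I) := by
  have D : ∀ {f}, Derives canonicalCall (limit I) f → f ∈ limit I := mem_limit_of_derives
  have push' : ∀ {k l v}, fact 0 k l (enc v) ∈ limit I →
      fact 0 1 (enc v) (enc (0 :: v)) ∈ limit I := by
    intro k l v h
    have := D (.push h)
    rwa [canonicalCall_zero] at this
  have inc' : ∀ {v : List ℕ}, fact 0 1 (enc v) (enc (0 :: v)) ∈ limit I → ∀ m,
      fact 0 2 (enc (m :: v)) (enc ((m + 1) :: v)) ∈ limit I := by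
    intro v h m
    induction m with
    | zero =>
      have := D (.inc_push h)
      rwa [canonicalCall_one] at this
    | succ m ih =>
      have := D (.inc_inc ih)
      rwa [canonicalCall_one] at this
  -- To prepend to `v`, some construction of `v` itself must be present: its last step is a push or
  -- an increment according to its head.
  have push : ∀ v : List ℕ, fact 0 1 (enc v) (enc (0 :: v)) ∈ limit I := by
    intro v
    induction v with
    | nil => exact push' h0
    | cons m v ih =>
      cases m with
      | zero => exact push' ih
      | succ m => exact push' (inc' ih m)
  have inc := fun m v => inc' (push v) m
  have zero : ∀ v : List ℕ, v.headI = 0 → fact 3 (enc v) (enc v) (enc v) ∈ limit I := by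
    intro v hv
    rcases v with _ | ⟨m, v⟩
    · exact D (.zero_nil h0)
    · obtain rfl : m = 0 := hv
      exact D (.zero_push (push v))
  refine ⟨h0, push, inc, zero, fun v => ?_, fun v t => ?_⟩
  · rcases v with _ | ⟨m, v⟩
    · exact D (.tail_nil h0)
    · induction m with
      | zero => exact D (.tail_push (push v))
      | succ m ih => exact D (.tail_inc (inc m v) ih)
  · rcases v with _ | ⟨m, v⟩
    · exact D (.cons_zero (zero [] rfl) (push t))
    · induction m with
      | zero => exact D (.cons_zero (zero (0 :: v) rfl) (push t))
      | succ m ih => exact D (.cons_inc ih (inc m v) (inc m t))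

/-- Induction on the evaluation tree: each of its rules is mirrored by a clause, and the auxiliary
list facts needed are all in the limit. -/
theorem eval_mem_limit {I : Instance} (hL : ListFacts (limit I)) {c : Code} {v w : List ℕ}
    (h : BigStep c v w) (hc : ∀ f ∈ codeFacts c, f ∈ limit I) :
    fact 4 (codeNum c) (enc v) (enc w) ∈ limit I := by
  have D : ∀ {f}, Derives canonicalCall (limit I) f → f ∈ limit I := mem_limit_of_derives
  have part : ∀ {f g : Code} {a : Fact}, (∀ b ∈ a :: (codeFacts f ++ codeFacts g), b ∈ limit I) →
      a ∈ limit I ∧ (∀ b ∈ codeFacts f, b ∈ limit I) ∧ ∀ b ∈ codeFacts g, b ∈ limit I := by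
    intro f g a h
    rwa [List.forall_mem_cons, List.forall_mem_append] at h
  induction h with
  | zero' v => exact D (.eval_zero (hc _ (List.mem_singleton.2 rfl)) (hL.push v))
  | succ v =>
    exact D (.eval_succ (hc _ (List.mem_singleton.2 rfl)) hL.nil (hL.cons v []) (hL.inc _ []))
  | tail v => exact D (.eval_tail (hc _ (List.mem_singleton.2 rfl)) (hL.tail v))
  | cons _ _ ih ih' =>
    obtain ⟨h, hf, hg⟩ := part hc
    exact D (.eval_cons h (ih hf) (ih' hg) (hL.cons _ _))
  | comp _ _ ih ih' =>
    obtain ⟨h, hf, hg⟩ := part hc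
    exact D (.eval_comp h (ih hg) (ih' hf))
  | case_zero h0 _ ih =>
    obtain ⟨h, hf, hg⟩ := part hc
    exact D (.eval_case_zero h (hL.zero _ h0) (hL.tail _) (ih hf))
  | case_succ _ ih =>
    obtain ⟨h, hf, hg⟩ := part hc
    exact D (.eval_case_succ h (hL.inc _ _) (ih hg))
  | fix_done _ h0 ih =>
    obtain ⟨h, hf⟩ := List.forall_mem_cons.1 hc
    exact D (.eval_fix_done h (ih hf) (hL.zero _ h0) (hL.tail _))
  | fix_step _ _ ih ih' =>
    obtain ⟨h, hf⟩ := List.forall_mem_cons.1 hc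
    exact D (.eval_fix_step h (ih hf) (hL.inc _ _) (hL.tail _) (ih' hc))

/-! ### The initial instance -/

/-- The part of the initial instance that does not depend on the input; the facts with tag `13`
only make the constants of the clauses available. -/
def staticFacts (C : Code) : List Fact :=
  (List.range 14).map (fun i => fact 13 i i i) ++ codeFacts C ++
    [fact 0 0 0 (enc []), fact 0 1 (enc []) (enc [0])]

/-- The initial instance for the code `C` and the input `[n]`. -/
def input (C : Code) (n : ℕ) : List Fact :=
  staticFacts C ++ fact 12 (codeNum C) (enc [n]) (enc [n]) ::
    -- The chain from `[0]` to `[n]` makes the input constant stand for `[n]` from the start,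
    -- independently of the services.
    (List.range n).map fun i => fact 0 2 (enc [i]) (enc [i + 1])

theorem computable_input (C : Code) : Computable (input C) := by
  have henc : Primrec fun i : ℕ => enc [i] :=
    Primrec.encode.comp (Primrec.list_cons.comp .id (.const []))
  have hfact : ∀ {f g : ℕ → ℕ} (t a : ℕ), Primrec f → Primrec g →
      Primrec fun i => fact t a (f i) (g i) := fun t a hf hg =>
    (Primrec.const 1).pair (Primrec.list_cons.comp (.const t) (Primrec.list_cons.comp (.const a)
      (Primrec.list_cons.comp hf (Primrec.list_cons.comp hg (.const [])))))
  refine Primrec.to_comp (Primrec.list_append.comp (.const _) (Primrec.list_cons.comp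
    (hfact _ _ henc henc) (Primrec.list_map Primrec.list_range ?_)))
  exact (hfact 0 2 henc (henc.comp .succ)).comp Primrec.snd

theorem exists_of_mem_codeFacts {C : Code} {f : Fact} (h : f ∈ codeFacts C) :
    ∃ t a b c, f = fact t a b c ∧ t ≠ 0 ∧ ∀ C n R, Sound C n R t a b c := by
  induction C with
  | zero' | succ | tail =>
    obtain rfl := List.mem_singleton.1 h
    exact ⟨_, _, _, _, rfl, by decide, fun _ _ _ => rfl⟩
  | cons f g ih ih' | comp f g ih ih' | case f g ih ih' =>
    rcases List.mem_cons.1 h with rfl | h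
    · exact ⟨_, _, _, _, rfl, by decide, fun _ _ _ => ⟨_, _, rfl, rfl, rfl⟩⟩
    · exact (List.mem_append.1 h).elim ih ih'
  | fix f ih =>
    rcases List.mem_cons.1 h with rfl | h
    · exact ⟨_, _, _, _, rfl, by decide, fun _ _ _ => ⟨_, rfl, rfl⟩⟩
    · exact ih h

/-- The first alternative collects code descriptions and padding facts, whose meaning involves
neither the input nor any lists. -/
theorem mem_input {C : Code} {n : ℕ} {f : Fact} (h : f ∈ input C n) :
    (∃ t a b c, f = fact t a b c ∧ t ≠ 0 ∧ ∀ C n R, Sound C n R t a b c) ∨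
    f = fact 0 0 0 (enc []) ∨ f = fact 0 1 (enc []) (enc [0]) ∨
    f = fact 12 (codeNum C) (enc [n]) (enc [n]) ∨
    ∃ i < n, f = fact 0 2 (enc [i]) (enc [i + 1]) := by
  simp only [input, staticFacts, List.mem_append, List.mem_cons, List.mem_map,
    List.not_mem_nil, or_false] at h
  rcases h with ((⟨i, -, rfl⟩ | h) | h | h) | h | ⟨i, hi, rfl⟩
  · exact Or.inl ⟨_, _, _, _, rfl, by decide, fun _ _ _ => trivial⟩
  · exact Or.inl (exists_of_mem_codeFacts h)
  · exact Or.inr (Or.inl h)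
  · exact Or.inr (Or.inr (Or.inl h))
  · exact Or.inr (Or.inr (Or.inr (Or.inl h)))
  · exact Or.inr (Or.inr (Or.inr (Or.inr ⟨i, List.mem_range.1 hi, rfl⟩)))

theorem mem_input_of_mem_codeFacts {C : Code} {n : ℕ} {f : Fact} (h : f ∈ codeFacts C) :
    f ∈ input C n := by
  simp [input, staticFacts, h]

theorem nil_mem_input (C : Code) (n : ℕ) : fact 0 0 0 (enc []) ∈ input C n := by
  simp [input, staticFacts]

theorem push_mem_input (C : Code) (n : ℕ) : fact 0 1 (enc []) (enc [0]) ∈ input C n := by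
  simp [input, staticFacts]

theorem start_mem_input (C : Code) (n : ℕ) :
    fact 12 (codeNum C) (enc [n]) (enc [n]) ∈ input C n := by
  simp [input, staticFacts]

theorem inc_mem_input (C : Code) {i n : ℕ} (h : i < n) :
    fact 0 2 (enc [i]) (enc [i + 1]) ∈ input C n := by
  simp only [input, List.mem_append, List.mem_cons, List.mem_map, List.mem_range]
  exact Or.inr (Or.inr ⟨i, h, rfl⟩)

theorem isValid_input (C : Code) (n : ℕ) : (system (input C n)).IsValid := by
  refine system_isValid (fun f hf => ?_) fun c hc => ?_
  · rcases mem_input hf with ⟨t, a, b, c, rfl, -⟩ | rfl | rfl | rfl | ⟨i, -, rfl⟩ <;> simp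
  · refine ⟨fact 13 c c c, ?_, by simp⟩
    change _ ∈ input C n
    simp only [input, staticFacts, List.mem_append, List.mem_map, List.mem_range]
    exact Or.inl (Or.inl (Or.inl ⟨c, hc, rfl⟩))

/-- The list facts supplied initially use the same names as the canonical services, so they cannot
collide with later ones. -/
theorem canonical_input (C : Code) (n : ℕ) : Canonical (system (input C n)).initInst := by
  intro k l d h
  rcases mem_input h with ⟨t, a, b, c, h, h0, -⟩ | h | h | h | ⟨i, -, h⟩ <;>
    rw [fact_inj] at h
  · exact absurd h.1.symm h0
  · exact Or.inl h.2
  · exact Or.inr (Or.inl ⟨h.2.1, [], h.2.2⟩)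
  · exact absurd h.1 (by decide)
  · exact Or.inr (Or.inr ⟨h.2.1, i, [], h.2.2⟩)

theorem soundInst_input (C : Code) (n : ℕ) : SoundInst C n (system (input C n)).initInst := by
  have hR : ∀ i ≤ n, Rep (system (input C n)).initInst (enc [i]) [i] := by
    intro i hi
    induction i with
    | zero => exact .push (push_mem_input C n) (.nil (nil_mem_input C n))
    | succ i ih => exact .inc (inc_mem_input C hi) (ih (by omega))
  refine ⟨fun t a b c h => ?_, fun h => ?_⟩
  · rcases mem_input h with ⟨t', a', b', c', h, -, hs⟩ | h | h | h | ⟨i, hi, h⟩ <;>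
      obtain ⟨rfl, rfl, rfl, rfl⟩ := fact_inj.1 h
    · exact hs C n _
    · exact Or.inl rfl
    · exact Or.inr (Or.inl ⟨rfl, [], .nil (nil_mem_input C n)⟩)
    · exact ⟨rfl, hR n le_rfl⟩
    · exact Or.inr (Or.inr ⟨rfl, i, [], hR i hi.le⟩)
  · rcases mem_input h with ⟨t, a, b, c, h, -⟩ | h | h | h | ⟨i, -, h⟩ <;> simp at h

/-! ### Correctness of the interpreter -/

theorem exists_halted_of_bigStep {C : Code} {n : ℕ} (h : ∃ w, BigStep C [n] w) :
    ∃ i, ((0, []) : Fact) ∈ canonicalRun (system (input C n)).initInst i := by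
  obtain ⟨w, hw⟩ := h
  have h0 : ∀ f ∈ input C n, f ∈ limit (system (input C n)).initInst := fun f hf => ⟨0, hf⟩
  have hL := listFacts_limit (h0 _ (nil_mem_input C n))
  exact mem_limit_of_derives (.halted (h0 _ (start_mem_input C n))
    (eval_mem_limit hL hw fun f hf => h0 f (mem_input_of_mem_codeFacts hf)))

/-- That a step was taken shows that its source is good, which is all that the preservation of
soundness needs. -/
theorem soundInst_of_isRun {C : Code} {n : ℕ} {N : ℕ∞} {I : ℕ → Instance}
    (h0 : I 0 = (system (input C n)).initInst)
    (hI : ∀ i : ℕ, (i : ℕ∞) < N → (system (input C n)).ctsNondet.step (I i) (I (i + 1))) (j : ℕ)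
    (hj : (j : ℕ∞) ≤ N) : SoundInst C n (I j) := by
  induction j with
  | zero => rw [h0]; exact soundInst_input C n
  | succ j ih =>
    have hlt : (j : ℕ∞) < N := lt_of_lt_of_le (by exact_mod_cast Nat.lt_succ_self j) hj
    obtain ⟨hg, θ, h⟩ := ctsNondet_step_iff.1 (hI j hlt)
    rw [h]
    exact (ih hlt.le).next hg

theorem ctsDet_models_iff {C : Code} {n : ℕ} :
    (system (input C n)).ctsDet.Models (.always (.neg (.atom 0))) ↔ ¬ ∃ w, BigStep C [n] w := by
  constructor
  · intro hm hw
    obtain ⟨i, hi⟩ := exists_halted_of_bigStep hw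
    -- The canonical answers are one total function of the call, so they are also admissible when
    -- results are recorded.
    obtain ⟨τ, hτ, hdb⟩ := DCDS.exists_ctsDet_run (S := system (input C n)) (θ := canonicalCall)
      (I := canonicalRun (system (input C n)).initInst) (α := action clauses) (σ := fun _ => 0)
      rfl (fun i => legal_iff.2 ⟨rfl, ((canonical_input C n).canonicalRun i).good⟩)
      (fun i => (canonicalRun_succ _ i).trans (apply_doo _ _ _ _).symm) fun i => consistent _ _
    refine LTL.holds_always_not_atom.1 (hm ⊤ τ hτ) i le_top ?_
    change _ ∈ (system (input C n)).ctsDet.db (τ i)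
    rwa [hdb]
  · intro hw N τ hτ
    -- Only the run property is used, so runs that stop at an ambiguous instance are covered as
    -- well.
    refine LTL.holds_always_not_atom.2 fun j hj hh => hw ?_
    exact (soundInst_of_isRun (I := fun i => (τ i).1) (congrArg Prod.fst hτ.1.1)
      (fun i hi => DCDS.ctsNondet_step_of_ctsDet_step (hτ.1.2 i hi)) j hj).2 hh

theorem ctsNondet_models_iff {C : Code} {n : ℕ} :
    (system (input C n)).ctsNondet.Models (.always (.neg (.atom 0))) ↔
      ¬ ∃ w, BigStep C [n] w := by
  constructor
  · intro hm hw
    obtain ⟨i, hi⟩ := exists_halted_of_bigStep hw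
    refine LTL.holds_always_not_atom.1 (hm ⊤ (canonicalRun (system (input C n)).initInst)
      ⟨⟨rfl, fun i _ => ctsNondet_step_iff.2
        ⟨((canonical_input C n).canonicalRun i).good, canonicalCall, canonicalRun_succ _ i⟩⟩,
        fun n hn => by cases hn⟩) i le_top hi
  · intro hw N τ hτ
    exact LTL.holds_always_not_atom.2 fun j hj hh =>
      hw ((soundInst_of_isRun hτ.1.1 hτ.1.2 j hj).2 hh)

end Interp

end DCDSVerif

/-! ### Undecidability by reduction from halting -/

open DCDSVerif in
theorem mainTheorem7 :
    ∃ (halted : ℕ) (Φ : LTL), Φ = LTL.always (LTL.neg (LTL.atom halted)) ∧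
      -- the input is a DCDS with the boolean predicate `halted`
      (¬ IsDecidable DCDS.code (fun S => S.IsValid ∧ (halted, 0) ∈ S.schema)
          (fun S => S.ctsDet.Models Φ)) ∧
      (¬ IsDecidable DCDS.code (fun S => S.IsValid ∧ (halted, 0) ∈ S.schema)
          (fun S => S.ctsNondet.Models Φ)) ∧
      -- the DCDS is fixed, and the input is its initial database instance
      ∃ S : DCDS, S.IsValid ∧ (halted, 0) ∈ S.schema ∧
        (¬ IsDecidable (id : List Fact → List Fact)
            (fun I₀ => (S.withInit I₀).IsValid)
            (fun I₀ => (S.withInit I₀).ctsDet.Models Φ)) ∧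
        (¬ IsDecidable (id : List Fact → List Fact)
            (fun I₀ => (S.withInit I₀).IsValid)
            (fun I₀ => (S.withInit I₀).ctsNondet.Models Φ)) := by
  obtain ⟨C, hC⟩ := exists_code_halting_undecidable
  -- The input `0` is an arbitrary choice: `withInit` overwrites the initial instance.
  let S := Interp.system (Interp.input C 0)
  have hdet : ¬ IsDecidable (id : List Fact → List Fact) (fun I₀ => (S.withInit I₀).IsValid)
      fun I₀ => (S.withInit I₀).ctsDet.Models (.always (.neg (.atom 0))) :=
    not_isDecidable_of_reduction hC (Interp.computable_input C) (Interp.isValid_input C)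
      fun _ => Interp.ctsDet_models_iff
  have hnondet : ¬ IsDecidable (id : List Fact → List Fact) (fun I₀ => (S.withInit I₀).IsValid)
      fun I₀ => (S.withInit I₀).ctsNondet.Models (.always (.neg (.atom 0))) :=
    not_isDecidable_of_reduction hC (Interp.computable_input C) (Interp.isValid_input C)
      fun _ => Interp.ctsNondet_models_iff
  have hmem : (0, 0) ∈ S.schema := List.mem_cons_self
  -- A decision procedure for all systems would in particular decide the instances of this one.
  exact ⟨0, _, rfl, fun h => hdet (DCDS.isDecidable_withInit (S := S) h fun _ hI => ⟨hI, hmem⟩),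
    fun h => hnondet (DCDS.isDecidable_withInit (S := S) h fun _ hI => ⟨hI, hmem⟩),
    S, Interp.isValid_input C 0, hmem, hdet, hnondet⟩
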